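/- Let $S_n$ be the group of permutations of $[n]=\{1,\dots,n\}$. Two permutations $\sigma,\tau\in S_n$ \emph{intersect} if $\sigma(k)=\tau(k)$ for some $k\in[n]$; families $\mathcal{A},\mathcal{B}\subset S_n$ are \emph{cross-intersecting} if every $\sigma\in\mathcal{A}$ intersects every $\tau\in\mathcal{B}$. A \emph{1-coset} is a set $\{\sigma\in S_n:\sigma(i)=j\}$ with $i,j\in[n]$. Let $d_m$ be the number of permutations of an $m$-element set without fixed points, and let $$\mathcal{C}=\{\sigma\in S_n:\ \sigma(1)=1,\ \sigma\text{ intersects }(1\ 2)\}\cup\{(1\ 2)\}.$$ There is an $N\geq 2$ such that the following holds for all $n\ge N$. If $\mathcal{A},\mathcal{B}\subset S_n$ are cross-intersecting and are not both contained within the same 1-coset, then $$\min(|\mathcal{A}|,|\mathcal{B}|)\ \le\ |\mathcal{C}|=(n-1)!-d_{n-1}-d_{n-2}+1,$$ with equality if and only if $$\mathcal{A}=\{\sigma\in S_n:\sigma(i)=j,\ \sigma\text{ intersects }\tau\}\cup\{\rho\},\qquad \mathcal{B}=\{\sigma\in S_n:\sigma(i)=j,\ \sigma\text{ intersects }\rho\}\cup\{\tau\}$$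 for some $i,j\in[n]$ and some $\tau,\rho\in S_n$ which intersect and satisfy $\tau(i)\ne j$, $\rho(i)\neq j$. -/

import Mathlib

namespace CrossInt

/-- Two permutations of `[n]` intersect if they agree at some point. -/
def Intersects {n : ℕ} (σ τ : Equiv.Perm (Fin n)) : Prop :=
  ∃ k, σ k = τ k

instance {n : ℕ} (σ τ : Equiv.Perm (Fin n)) : Decidable (Intersects σ τ) :=
  inferInstanceAs (Decidable (∃ k, σ k = τ k))

/-- A pair of families is cross-intersecting if every member of the first intersects every
member of the second. -/
def CrossIntersecting {n : ℕ} (A B : Finset (Equiv.Perm (Fin n))) : Prop :=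
  ∀ σ ∈ A, ∀ τ ∈ B, Intersects σ τ

/-- The 1-coset of all permutations mapping `i` to `j`. -/
def oneCoset {n : ℕ} (i j : Fin n) : Finset (Equiv.Perm (Fin n)) :=
  {σ | σ i = j}

/-- The permutations that map `i` to `j` and intersect `τ`. -/
def cosetMeeting {n : ℕ} (i j : Fin n) (τ : Equiv.Perm (Fin n)) :
    Finset (Equiv.Perm (Fin n)) :=
  {σ | σ i = j ∧ Intersects σ τ}

/-- The family `{σ : σ(1) = 1, σ intersects (1 2)} ∪ {(1 2)}`. The points `1`, `2` of `[n]` are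
`0`, `1` in `Fin n`. -/
def familyC (n : ℕ) (h : 2 ≤ n) : Finset (Equiv.Perm (Fin n)) :=
  cosetMeeting ⟨0, by omega⟩ ⟨0, by omega⟩ (Equiv.swap ⟨0, by omega⟩ ⟨1, by omega⟩) ∪
    {Equiv.swap ⟨0, by omega⟩ ⟨1, by omega⟩}

end CrossInt

/-!
Write `d_m` for the number of derangements of `m` points. Both families are assumed to have at least
`(n - 1)! - d_{n-1} - d_{n-2} + 1 > (n - 1)! / 2` members.

*Stability.* View a permutation as its graph, a set of `n` points in a square. The number of
permutations through `k` given points shrinks quickly with `k`, so up to a small fraction of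
`(n - 1)!` each family is covered by small cores above which it is spread: no further set of points
has too large a share of the members. Two spread families always have disjoint members: colour the
points at random with four colours; with probability more than one half some member of the first
family uses only the first two colours, because what the first of these colours leaves uncovered is
typically small and still spread, hence likely to be covered by the second. The same holds for the
second family and the other two colours. Therefore the cores of the two families intersect pairwise,
and as neither family can be covered by few pairs of points, all cores pass through one point
`(i, j)`. So both families lie in the 1-coset of `i ↦ j` up to a small error.

*Exact structure.* A member `τ` of one family outside the coset forbids the `d_{n-1} + d_{n-2}`
members of the coset that avoid `τ`, and two such members `π ≠ τ` forbid in addition the members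
that avoid `τ` but meet `π`. Unless `π` and `τ` agree at a quarter of all points, a second moment
argument shows that the latter make up a positive fraction of the coset, more than the error. Hence
at most `d_{n-2}` members lie outside. There are always at least `d_{n-2}` permutations in the coset
separating `π` from `τ`, so each family has exactly one member outside the coset, which determines
both families.
-/

namespace CrossInt

open Equiv Finset
open scoped Nat

section Colouring

variable {V C : Type*} [Fintype V] [DecidableEq C]

/-- The points of colour `γ` in the colouring `c`. -/
def colourClass (γ : C) (c : V → C) : Finset V := {v | c v = γ}

@[simp]
theorem mem_colourClass {γ : C} {c : V → C} {v : V} : v ∈ colourClass γ c ↔ c v = γ := by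
  simp [colourClass]

end Colouring

section Spread

variable {ι V C : Type*} [DecidableEq V] {A A' : Finset ι} {S S' : ι → Finset V} {W Z : Finset V}
  {i : ι} {k s : ℕ} {M M' ρ θ a : ℝ}

/-- The family `(S i)`, `i ∈ A`, is `ρ`-spread with mass `M`: at most `M * ρ ^ |Y|` of its members,
counted with multiplicity, contain a given set `Y`. -/
def IsSpread (A : Finset ι) (S : ι → Finset V) (M ρ : ℝ) : Prop :=
  ∀ Y : Finset V, (#{i ∈ A | Y ⊆ S i} : ℝ) ≤ M * ρ ^ #Y

theorem IsSpread.card_le (h : IsSpread A S M ρ) : (#A : ℝ) ≤ M := by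
  simpa using h ∅

theorem IsSpread.mono (h : IsSpread A S M ρ) (hρ : 0 ≤ ρ) (hA : A' ⊆ A) (hM : M ≤ M')
    (hS : ∀ i ∈ A', S' i ⊆ S i) : IsSpread A' S' M' ρ := by
  intro Y
  have hsub : #{i ∈ A' | Y ⊆ S' i} ≤ #{i ∈ A | Y ⊆ S i} := by
    refine card_le_card fun i hi => ?_
    rw [mem_filter] at hi ⊢
    exact ⟨hA hi.1, hi.2.trans (hS i hi.1)⟩
  calc (#{i ∈ A' | Y ⊆ S' i} : ℝ) ≤ #{i ∈ A | Y ⊆ S i} := by exact_mod_cast hsub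
    _ ≤ M * ρ ^ #Y := h Y
    _ ≤ M' * ρ ^ #Y := by gcongr

/-- A minimum fragment of `S i` with respect to `W`: what `W` misses of a member of the family that
lies in `W ∪ S i`, where `W` misses as few points as possible. The choice of a smallest one enters
only through `subset_of_subset_union`. -/
structure IsFragment (A : Finset ι) (S : ι → Finset V) (W : Finset V) (i : ι) (Z : Finset V) :
    Prop where
  subset : Z ⊆ S i
  exists_sdiff_eq : ∃ j ∈ A, S j \ W = Z
  subset_of_subset_union : ∀ l ∈ A, S l ⊆ W ∪ Z → Z ⊆ S l

theorem exists_isFragment (S : ι → Finset V) (W : Finset V) (hi : i ∈ A) :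
    ∃ Z, IsFragment A S W i Z := by
  obtain ⟨j, hj, hmin⟩ := exists_min_image {j ∈ A | S j ⊆ W ∪ S i} (fun j => #(S j \ W))
    ⟨i, by simp [hi]⟩
  simp only [mem_filter] at hj hmin
  have hji : S j \ W ⊆ S i := sdiff_le_iff.2 hj.2
  refine ⟨S j \ W, hji, ⟨j, hj.1, rfl⟩, fun l hl hlW => ?_⟩
  have hlj : S l \ W ⊆ S j \ W := sdiff_le_iff.2 hlW
  have hcard := hmin l ⟨hl, hlW.trans (union_subset_union_right hji)⟩
  exact (eq_of_subset_of_card_le hlj hcard).ge.trans sdiff_subset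

/-- A chosen minimum fragment of `S i`; meaningful only for `i ∈ A`. -/
noncomputable def fragment (A : Finset ι) (S : ι → Finset V) (W : Finset V) (i : ι) : Finset V :=
  Classical.epsilon (IsFragment A S W i)

theorem isFragment_fragment (S : ι → Finset V) (W : Finset V) (hi : i ∈ A) :
    IsFragment A S W i (fragment A S W i) :=
  Classical.epsilon_spec (exists_isFragment S W hi)

theorem IsFragment.disjoint (h : IsFragment A S W i Z) : Disjoint W Z := by
  obtain ⟨j, -, rfl⟩ := h.exists_sdiff_eq
  exact disjoint_sdiff

theorem IsFragment.exists_subset_union (h : IsFragment A S W i Z) : ∃ l ∈ A, S l ⊆ W ∪ Z := by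
  obtain ⟨j, hj, rfl⟩ := h.exists_sdiff_eq
  exact ⟨j, hj, by simp⟩

variable [Fintype V]

/-- The sets contained in every member of the family that lies in `U`; there are none if no member
lies in `U`. -/
def commonSubsets (A : Finset ι) (S : ι → Finset V) (U : Finset V) : Finset (Finset V) :=
  {Z | (∃ l ∈ A, S l ⊆ U) ∧ ∀ l ∈ A, S l ⊆ U → Z ⊆ S l}

theorem IsFragment.mem_commonSubsets (h : IsFragment A S W i Z) :
    Z ∈ commonSubsets A S (W ∪ Z) := by
  simpa [commonSubsets] using ⟨h.exists_subset_union, h.subset_of_subset_union⟩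

theorem sum_pow_card_commonSubsets_le (hk : ∀ i ∈ A, #(S i) ≤ k) (ha : 0 ≤ a) (U : Finset V) :
    ∑ Z ∈ commonSubsets A S U, a ^ #Z ≤ (1 + a) ^ k := by
  rcases (commonSubsets A S U).eq_empty_or_nonempty with hempty | ⟨Z₀, hZ₀⟩
  · rw [hempty, sum_empty]
    positivity
  · obtain ⟨⟨l, hl, hlU⟩, -⟩ := (mem_filter.1 hZ₀).2
    have hsub : commonSubsets A S U ⊆ (S l).powerset := fun Z hZ =>
      mem_powerset.2 ((mem_filter.1 hZ).2.2 l hl hlU)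
    calc ∑ Z ∈ commonSubsets A S U, a ^ #Z ≤ ∑ Z ∈ (S l).powerset, a ^ #Z :=
          sum_le_sum_of_subset_of_nonneg hsub fun _ _ _ => by positivity
      _ = (1 + a) ^ #(S l) := by simpa [add_comm] using sum_pow_mul_eq_add_pow a 1 (S l)
      _ ≤ (1 + a) ^ k := pow_le_pow_right₀ (by linarith) (hk l hl)

variable [DecidableEq C]

theorem colourClass_piecewise (γ : C) (c : V → C) (Z : Finset V) :
    colourClass γ (Z.piecewise (fun _ => γ) c) = colourClass γ c ∪ Z := by
  ext v
  by_cases hv : v ∈ Z <;> simp [hv]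

/-- The colouring that recolours with `γ` the fragment of `S i` with respect to the points of colour
`γ`, paired with that fragment. -/
noncomputable def absorbFragment (A : Finset ι) (S : ι → Finset V) (γ : C) (p : (V → C) × ι) :
    Σ _ : V → C, Finset V :=
  ⟨(fragment A S (colourClass γ p.1) p.2).piecewise (fun _ => γ) p.1,
    fragment A S (colourClass γ p.1) p.2⟩

theorem absorbFragment_eq_imp {γ : C} {c c' : V → C} (hi : i ∈ A)
    (h : absorbFragment A S γ (c, i) = ⟨c', Z⟩) :
    Z ⊆ S i ∧ (∀ v ∈ Z, c v ≠ γ) ∧ (∀ v ∉ Z, c v = c' v) := by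
  simp only [absorbFragment, Sigma.mk.injEq, heq_eq_eq] at h
  obtain ⟨rfl, rfl⟩ := h
  have hZ := isFragment_fragment S (colourClass γ c) hi
  refine ⟨hZ.subset, fun v hv hcv => ?_, fun v hv => ?_⟩
  · exact disjoint_right.1 hZ.disjoint hv (mem_colourClass.2 hcv)
  · exact (piecewise_eq_of_notMem _ _ _ hv).symm

theorem absorbFragment_mem {L : V → Finset C} {γ : C} (hL : ∀ i ∈ A, ∀ v ∈ S i, γ ∈ L v)
    {p : (V → C) × ι} (hp : p ∈ Fintype.piFinset L ×ˢ A) :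
    absorbFragment A S γ p ∈
      (Fintype.piFinset L).sigma fun c => commonSubsets A S (colourClass γ c) := by
  obtain ⟨hc, hi⟩ := mem_product.1 hp
  have hZ := isFragment_fragment S (colourClass γ p.1) hi
  refine mem_sigma.2 ⟨Fintype.mem_piFinset.2 fun v => ?_, ?_⟩
  · by_cases hv : v ∈ fragment A S (colourClass γ p.1) p.2
    · simpa [absorbFragment, hv] using hL p.2 hi v (hZ.subset hv)
    · simpa [absorbFragment, hv] using Fintype.mem_piFinset.1 hc v
  · simpa only [absorbFragment, colourClass_piecewise] using hZ.mem_commonSubsets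

theorem card_piFinset_erase_le {L : V → Finset C} {γ : C} (c' : V → C)
    (hL : ∀ v ∈ Z, γ ∈ L v ∧ #(L v) ≤ s + 1) :
    #(Fintype.piFinset fun v => if v ∈ Z then (L v).erase γ else {c' v}) ≤ s ^ #Z := by
  calc #(Fintype.piFinset fun v => if v ∈ Z then (L v).erase γ else {c' v})
      = ∏ v, #(if v ∈ Z then (L v).erase γ else {c' v}) := Fintype.card_piFinset _
    _ ≤ ∏ v, if v ∈ Z then s else 1 := by
        refine prod_le_prod' fun v _ => ?_
        split_ifs with hv
        · rw [card_erase_of_mem (hL v hv).1]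
          have := (hL v hv).2
          omega
        · simp
    _ = s ^ #Z := by simp

theorem card_absorbFragment_fibre_le (hS : IsSpread A S M ρ) (hρ : 0 ≤ ρ) {L : V → Finset C}
    {γ : C} (hL : ∀ i ∈ A, ∀ v ∈ S i, γ ∈ L v ∧ #(L v) ≤ s + 1) (c' : V → C) (Z : Finset V) :
    (#{p ∈ Fintype.piFinset L ×ˢ A | absorbFragment A S γ p = ⟨c', Z⟩} : ℝ) ≤
      M * (s * ρ) ^ #Z := by
  have hM : 0 ≤ M := (Nat.cast_nonneg _).trans hS.card_le
  let Q : Finset (V → C) := Fintype.piFinset fun v => if v ∈ Z then (L v).erase γ else {c' v}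
  have hsub : {p ∈ Fintype.piFinset L ×ˢ A | absorbFragment A S γ p = ⟨c', Z⟩} ⊆
      Q ×ˢ {i ∈ A | Z ⊆ S i} := by
    rintro ⟨c, i⟩ hp
    simp only [mem_filter, mem_product] at hp ⊢
    obtain ⟨⟨hc, hi⟩, h⟩ := hp
    obtain ⟨hZ, hcZ, hcc'⟩ := absorbFragment_eq_imp hi h
    refine ⟨Fintype.mem_piFinset.2 fun v => ?_, hi, hZ⟩
    by_cases hv : v ∈ Z
    · simpa [hv] using ⟨hcZ v hv, Fintype.mem_piFinset.1 hc v⟩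
    · simpa [hv] using hcc' v hv
  rcases (filter (fun i => Z ⊆ S i) A).eq_empty_or_nonempty with hempty | ⟨i, hi⟩
  · rw [hempty, product_empty, subset_empty] at hsub
    rw [hsub]
    simpa using by positivity
  obtain ⟨hi, hZi⟩ := mem_filter.1 hi
  calc (#{p ∈ Fintype.piFinset L ×ˢ A | absorbFragment A S γ p = ⟨c', Z⟩} : ℝ)
      ≤ #Q * #{i ∈ A | Z ⊆ S i} := by
        exact_mod_cast (card_le_card hsub).trans (card_product _ _).le
    _ ≤ s ^ #Z * (M * ρ ^ #Z) := by
        gcongr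
        · exact_mod_cast card_piFinset_erase_le c' fun v hv => hL i hi v (hZi hv)
        · exact hS Z
    _ = M * (s * ρ) ^ #Z := by ring

/-- Giving the fragment the colour `γ` loses little information: the fragment is a subset of a set
of size `k` determined by the new colouring, which in turn determines the old one outside it. -/
theorem sum_pow_card_fragment_le (hS : IsSpread A S M ρ) (hρ : 0 ≤ ρ) (hk : ∀ i ∈ A, #(S i) ≤ k)
    {L : V → Finset C} {γ : C} (hL : ∀ i ∈ A, ∀ v ∈ S i, γ ∈ L v ∧ #(L v) ≤ s + 1) (hθ : 0 ≤ θ) :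
    ∑ c ∈ Fintype.piFinset L, ∑ i ∈ A, θ ^ #(fragment A S (colourClass γ c) i) ≤
      #(Fintype.piFinset L) * M * (1 + θ * s * ρ) ^ k := by
  have hM : 0 ≤ M := (Nat.cast_nonneg _).trans hS.card_le
  calc ∑ c ∈ Fintype.piFinset L, ∑ i ∈ A, θ ^ #(fragment A S (colourClass γ c) i)
      = ∑ p ∈ Fintype.piFinset L ×ˢ A, θ ^ #(absorbFragment A S γ p).2 := by
        rw [sum_product]
        rfl
    _ = ∑ r ∈ (Fintype.piFinset L).sigma fun c => commonSubsets A S (colourClass γ c),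
          #{p ∈ Fintype.piFinset L ×ˢ A | absorbFragment A S γ p = r} * θ ^ #r.2 := by
        rw [← sum_fiberwise_of_maps_to fun p =>
          absorbFragment_mem fun i hi v hv => (hL i hi v hv).1]
        refine sum_congr rfl fun r _ => ?_
        rw [← nsmul_eq_mul, ← sum_const]
        exact sum_congr rfl fun p hp => by rw [(mem_filter.1 hp).2]
    _ ≤ ∑ r ∈ (Fintype.piFinset L).sigma fun c => commonSubsets A S (colourClass γ c),
          M * (s * ρ) ^ #r.2 * θ ^ #r.2 := by
        gcongr with r
        exact card_absorbFragment_fibre_le hS hρ hL r.1 r.2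
    _ = ∑ c ∈ Fintype.piFinset L,
          M * ∑ Z ∈ commonSubsets A S (colourClass γ c), (θ * s * ρ) ^ #Z := by
        rw [sum_sigma]
        simp only [mul_sum, mul_pow]
        exact sum_congr rfl fun c _ => sum_congr rfl fun Z _ => by ring
    _ ≤ ∑ c ∈ Fintype.piFinset L, M * (1 + θ * s * ρ) ^ k := by
        gcongr
        exact sum_pow_card_commonSubsets_le hk (by positivity) _
    _ = #(Fintype.piFinset L) * M * (1 + θ * s * ρ) ^ k := by
        rw [sum_const, nsmul_eq_mul]
        ring

end Spread

section Covering

variable {ι V C : Type*} [DecidableEq V] {A : Finset ι} {S : ι → Finset V} {W : Finset V}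
  {i : ι} {k m : ℕ} {ρ θ : ℝ}

/-- The members of the family whose fragment with respect to `W` has fewer than `m` points. -/
noncomputable def smallFragments (A : Finset ι) (S : ι → Finset V) (W : Finset V) (m : ℕ) :
    Finset ι :=
  {i ∈ A | #(fragment A S W i) < m}

theorem exists_subset_of_mem_smallFragments_one (hi : i ∈ smallFragments A S W 1) :
    ∃ l ∈ A, S l ⊆ W := by
  obtain ⟨hi, hcard⟩ := mem_filter.1 hi
  have hempty : fragment A S W i = ∅ := by simpa using hcard
  simpa [hempty] using (isFragment_fragment S W hi).exists_subset_union

theorem card_sub_card_smallFragments_mul_pow_le (hθ : 1 ≤ θ) :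
    (#A - #(smallFragments A S W m) : ℝ) * θ ^ m ≤ ∑ i ∈ A, θ ^ #(fragment A S W i) := by
  have hcard : #(smallFragments A S W m) + #{i ∈ A | ¬ #(fragment A S W i) < m} = #A :=
    card_filter_add_card_filter_not _
  calc (#A - #(smallFragments A S W m) : ℝ) * θ ^ m
      = ∑ i ∈ A with ¬ #(fragment A S W i) < m, θ ^ m := by
        rw [sum_const, nsmul_eq_mul, ← hcard]
        push_cast
        ring
    _ ≤ ∑ i ∈ A with ¬ #(fragment A S W i) < m, θ ^ #(fragment A S W i) :=
        sum_le_sum fun i hi => pow_le_pow_right₀ hθ (not_lt.1 (mem_filter.1 hi).2)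
    _ ≤ ∑ i ∈ A, θ ^ #(fragment A S W i) :=
        sum_le_sum_of_subset_of_nonneg (filter_subset _ _) fun _ _ _ => by positivity

variable [Fintype V]

theorem card_few_smallFragments_le (hS : IsSpread A S (2 * #A) ρ) (hA : A.Nonempty) (hρ : 0 ≤ ρ)
    (hk : ∀ i ∈ A, #(S i) ≤ k) (hm : 16 * (1 + 6 * ρ) ^ k ≤ 2 ^ m) (a : Fin 4) :
    4 * #{c : V → Fin 4 | 2 * #(smallFragments A S (colourClass a c) m) ≤ #A} ≤
      4 ^ Fintype.card V := by
  set bad : Finset (V → Fin 4) := {c | 2 * #(smallFragments A S (colourClass a c) m) ≤ #A}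
  have : (0 : ℝ) < #A := by exact_mod_cast hA.card_pos
  have hlower : (#bad : ℝ) * (#A / 2 * 2 ^ m) ≤
      ∑ c : V → Fin 4, ∑ i ∈ A, (2 : ℝ) ^ #(fragment A S (colourClass a c) i) := by
    calc (#bad : ℝ) * (#A / 2 * 2 ^ m) = ∑ c ∈ bad, (#A / 2 * 2 ^ m : ℝ) := by
          rw [sum_const, nsmul_eq_mul]
      _ ≤ ∑ c ∈ bad, ∑ i ∈ A, (2 : ℝ) ^ #(fragment A S (colourClass a c) i) := by
          refine sum_le_sum fun c hc => ?_
          have hc : (2 * #(smallFragments A S (colourClass a c) m) : ℝ) ≤ #A := by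
            exact_mod_cast (mem_filter.1 hc).2
          refine le_trans ?_ (card_sub_card_smallFragments_mul_pow_le (m := m) one_le_two)
          gcongr
          linarith
      _ ≤ _ := sum_le_univ_sum_of_nonneg fun c => sum_nonneg fun i _ => by positivity
  have hupper := sum_pow_card_fragment_le (L := fun _ : V => (univ : Finset (Fin 4))) (γ := a)
    (s := 3) (θ := 2) hS hρ hk (by simp) zero_le_two
  simp only [Fintype.piFinset_univ, card_univ, Fintype.card_fun, Fintype.card_fin] at hupper
  have hbad : (4 * #bad : ℝ) * (#A * 2 ^ m) ≤ 4 ^ Fintype.card V * (#A * 2 ^ m) := by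
    have hmul : (4 : ℝ) ^ Fintype.card V * #A * (16 * (1 + 6 * ρ) ^ k) ≤
        4 ^ Fintype.card V * #A * 2 ^ m := by gcongr
    norm_num at hupper
    linarith
  exact_mod_cast le_of_mul_le_mul_right hbad (by positivity)

/-- The colourings in which every member of the family has a point whose colour is neither `a` nor
`b`. -/
def missingColourings [Fintype C] [DecidableEq C] (A : Finset ι) (S : ι → Finset V) (a b : C) :
    Finset (V → C) :=
  {c | ∀ i ∈ A, ∃ v ∈ S i, c v ≠ a ∧ c v ≠ b}

theorem filter_colourClass_eq [Fintype C] [DecidableEq C] (a : C) (W : Finset V) :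
    ({c | colourClass a c = W} : Finset (V → C)) =
      Fintype.piFinset fun v => if v ∈ W then {a} else univ.erase a := by
  ext c
  simp only [mem_filter, mem_univ, true_and, Fintype.mem_piFinset, Finset.ext_iff, mem_colourClass]
  refine forall_congr' fun v => ?_
  by_cases hv : v ∈ W <;> simp [hv]

theorem smallFragments_eq_empty_of_mem_missingColourings [Fintype C] [DecidableEq C] {a b : C}
    {c : V → C} (hc : c ∈ missingColourings A S a b) :
    smallFragments (smallFragments A S (colourClass a c) m) (fragment A S (colourClass a c))
      (colourClass b c) 1 = ∅ := by
  refine eq_empty_of_forall_notMem fun j hj => ?_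
  obtain ⟨l, hl, hlb⟩ := exists_subset_of_mem_smallFragments_one hj
  obtain ⟨i, hi, hia⟩ :=
    (isFragment_fragment S (colourClass a c) (mem_filter.1 hl).1).exists_subset_union
  obtain ⟨v, hv, hva, hvb⟩ := (mem_filter.1 hc).2 i hi
  rcases mem_union.1 (hia hv) with h | h
  · exact hva (mem_colourClass.1 h)
  · exact hvb (mem_colourClass.1 (hlb h))

theorem card_missingColourings_mul_le_sum_pow [Fintype C] [DecidableEq C] (hθ : 1 ≤ θ) (a b : C) :
    (#{c ∈ missingColourings A S a b | colourClass a c = W} : ℝ) *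
        (#(smallFragments A S W m) * θ) ≤
      ∑ c with colourClass a c = W, ∑ i ∈ smallFragments A S W m,
        θ ^ #(fragment (smallFragments A S W m) (fragment A S W) (colourClass b c) i) := by
  rw [← nsmul_eq_mul, ← sum_const]
  refine (sum_le_sum fun c hc => ?_).trans (sum_le_sum_of_subset_of_nonneg
    (filter_subset_filter _ (subset_univ _)) fun c _ _ => by positivity)
  obtain ⟨hmissing, rfl⟩ := mem_filter.1 hc
  simpa [smallFragments_eq_empty_of_mem_missingColourings hmissing] using
    card_sub_card_smallFragments_mul_pow_le (A := smallFragments A S (colourClass a c) m)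
      (S := fragment A S (colourClass a c)) (W := colourClass b c) (m := 1) hθ

/-- Once the points of colour `a` are fixed, the remaining points have three colours left, and the
small fragments are again spread. -/
theorem card_missingColourings_colourClass_eq_le (hS : IsSpread A S (2 * #A) ρ) (hρ : 0 ≤ ρ)
    (hm : (1 + 128 * ρ) ^ m ≤ 2) {a b : Fin 4} (hab : a ≠ b)
    (hW : #A < 2 * #(smallFragments A S W m)) :
    8 * #{c ∈ missingColourings A S a b | colourClass a c = W} ≤
      #{c : V → Fin 4 | colourClass a c = W} := by
  have hlower := card_missingColourings_mul_le_sum_pow (A := A) (S := S) (W := W) (m := m)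
    (θ := 64) (by norm_num) a b
  set B := smallFragments A S W m
  have hfragment : ∀ i ∈ B, IsFragment A S W i (fragment A S W i) := fun i hi =>
    isFragment_fragment S W (mem_filter.1 hi).1
  have hspread : IsSpread B (fragment A S W) (2 * #A) ρ :=
    hS.mono hρ (filter_subset _ _) le_rfl fun i hi => (hfragment i hi).subset
  have hcolours : ∀ i ∈ B, ∀ v ∈ fragment A S W i,
      b ∈ (if v ∈ W then {a} else univ.erase a) ∧ #(if v ∈ W then {a} else univ.erase a) ≤ 2 + 1 :=
    fun i hi v hv => by simp [disjoint_right.1 (hfragment i hi).disjoint hv, hab.symm]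
  have hupper := sum_pow_card_fragment_le (θ := 64) hspread hρ
    (fun i hi => (mem_filter.1 hi).2.le) hcolours (by norm_num)
  rw [← filter_colourClass_eq] at hupper
  set N := #{c : V → Fin 4 | colourClass a c = W}
  have hB : (#A : ℝ) ≤ 2 * #B := by exact_mod_cast hW.le
  have hBpos : (0 : ℝ) < #B := by exact_mod_cast (by omega : 0 < #B)
  have hmul : (N : ℝ) * (2 * #A) * (1 + 128 * ρ) ^ m ≤ N * (2 * (2 * #B)) * 2 := by gcongr
  norm_num at hupper
  have hfinal : (8 * #{c ∈ missingColourings A S a b | colourClass a c = W} : ℝ) * #B ≤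
      N * #B := by linarith
  exact_mod_cast le_of_mul_le_mul_right hfinal hBpos

theorem two_mul_card_missingColourings_lt (hS : IsSpread A S (2 * #A) ρ) (hA : A.Nonempty)
    (hρ : 0 ≤ ρ) (hk : ∀ i ∈ A, #(S i) ≤ k) (h1 : 16 * (1 + 6 * ρ) ^ k ≤ 2 ^ m)
    (h2 : (1 + 128 * ρ) ^ m ≤ 2) {a b : Fin 4} (hab : a ≠ b) :
    2 * #(missingColourings A S a b) < 4 ^ Fintype.card V := by
  have hbad := card_few_smallFragments_le hS hA hρ hk h1 a
  let few : (V → Fin 4) → Prop := fun c => 2 * #(smallFragments A S (colourClass a c) m) ≤ #A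
  have hgood : 8 * #{c ∈ missingColourings A S a b | ¬ few c} ≤ 4 ^ Fintype.card V := by
    calc 8 * #{c ∈ missingColourings A S a b | ¬ few c}
        = ∑ W : Finset V, 8 * #{c ∈ missingColourings A S a b | ¬ few c ∧ colourClass a c = W} := by
          rw [card_eq_sum_card_fiberwise (f := colourClass a) (t := univ) (by simp), mul_sum]
          simp only [filter_filter]
      _ ≤ ∑ W : Finset V, #{c : V → Fin 4 | colourClass a c = W} := by
          refine sum_le_sum fun W _ => ?_
          by_cases hW : 2 * #(smallFragments A S W m) ≤ #A
          · have hempty : #{c ∈ missingColourings A S a b | ¬ few c ∧ colourClass a c = W} = 0 := by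
              refine card_eq_zero.2 (filter_eq_empty_iff.2 fun c _ hc => hc.1 ?_)
              simpa only [few, hc.2] using hW
            omega
          · refine le_trans ?_
              (card_missingColourings_colourClass_eq_le hS hρ h2 hab (not_le.1 hW))
            gcongr with c
            exact And.right
      _ = 4 ^ Fintype.card V := by
          rw [← card_eq_sum_card_fiberwise (by simp)]
          simp
  have hsplit : #(missingColourings A S a b) ≤
      #{c | few c} + #{c ∈ missingColourings A S a b | ¬ few c} := by
    rw [← card_filter_add_card_filter_not few]
    gcongr
    exact subset_univ _
  have hpos : 0 < 4 ^ Fintype.card V := by positivity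
  simp only [few] at hgood hsplit
  omega

end Covering

section Core

variable {ι κ V : Type*} [DecidableEq V] {A R F : Finset ι} {B : Finset κ} {S : ι → Finset V}
  {T : κ → Finset V} {X X' : Finset V} {k m q : ℕ} {ρ D E : ℝ}

/-- `X` is a core of the family if some nonempty subfamily consists of supersets of `X` and is
`ρ`-spread outside `X`. -/
def IsCore (A : Finset ι) (S : ι → Finset V) (ρ : ℝ) (X : Finset V) : Prop :=
  ∃ F ⊆ A, F.Nonempty ∧ (∀ i ∈ F, X ⊆ S i) ∧ IsSpread F (fun i => S i \ X) #F ρ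

theorem IsCore.mono (h : IsCore R S ρ X) (hRA : R ⊆ A) : IsCore A S ρ X := by
  obtain ⟨F, hF, h⟩ := h
  exact ⟨F, hF.trans hRA, h⟩

theorem card_le_two_mul_card_filter_disjoint (hF : IsSpread F S #F ρ) (hX : 2 * #X * ρ ≤ 1) :
    (#F : ℝ) ≤ 2 * #{i ∈ F | Disjoint X (S i)} := by
  classical
  have hcover : {i ∈ F | ¬ Disjoint X (S i)} ⊆ X.biUnion fun x => {i ∈ F | {x} ⊆ S i} := by
    intro i hi
    obtain ⟨hiF, h⟩ := mem_filter.1 hi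
    obtain ⟨x, hx, hxi⟩ := not_disjoint_iff.1 h
    exact mem_biUnion.2 ⟨x, hx, mem_filter.2 ⟨hiF, singleton_subset_iff.2 hxi⟩⟩
  have hmeet : (2 * #{i ∈ F | ¬ Disjoint X (S i)} : ℝ) ≤ #F := by
    calc (2 * #{i ∈ F | ¬ Disjoint X (S i)} : ℝ) ≤ 2 * ∑ x ∈ X, (#{i ∈ F | {x} ⊆ S i} : ℝ) := by
          gcongr
          exact_mod_cast (card_le_card hcover).trans card_biUnion_le
      _ ≤ 2 * ∑ _x ∈ X, (#F * ρ) := by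
          gcongr with x
          simpa only [card_singleton, pow_one] using hF {x}
      _ = 2 * #X * ρ * #F := by
          rw [sum_const, nsmul_eq_mul]
          ring
      _ ≤ #F := mul_le_of_le_one_left (Nat.cast_nonneg _) hX
  have hsplit : (#{i ∈ F | Disjoint X (S i)} : ℝ) + #{i ∈ F | ¬ Disjoint X (S i)} = #F := by
    exact_mod_cast card_filter_add_card_filter_not _
  linarith

theorem exists_disjoint_of_isSpread [Finite V] (hS : IsSpread A S (2 * #A) ρ)
    (hA : A.Nonempty) (hT : IsSpread B T (2 * #B) ρ) (hB : B.Nonempty) (hρ : 0 ≤ ρ)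
    (hSk : ∀ i ∈ A, #(S i) ≤ k) (hTk : ∀ j ∈ B, #(T j) ≤ k) (h1 : 16 * (1 + 6 * ρ) ^ k ≤ 2 ^ m)
    (h2 : (1 + 128 * ρ) ^ m ≤ 2) : ∃ i ∈ A, ∃ j ∈ B, Disjoint (S i) (T j) := by
  have := Fintype.ofFinite V
  have hcardA := two_mul_card_missingColourings_lt hS hA hρ hSk h1 h2 (by decide : (0 : Fin 4) ≠ 1)
  have hcardB := two_mul_card_missingColourings_lt hT hB hρ hTk h1 h2 (by decide : (2 : Fin 4) ≠ 3)
  obtain ⟨c, hc⟩ : ∃ c, c ∉ missingColourings A S 0 1 ∪ missingColourings B T (2 : Fin 4) 3 := by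
    by_contra! hall
    have hcard := card_union_le (missingColourings A S 0 1) (missingColourings B T (2 : Fin 4) 3)
    rw [eq_univ_of_forall hall, card_univ, Fintype.card_fun, Fintype.card_fin] at hcard
    omega
  simp only [missingColourings, mem_union, mem_filter, mem_univ, true_and, not_or] at hc
  push Not at hc
  obtain ⟨⟨i, hi, hic⟩, j, hj, hjc⟩ := hc
  refine ⟨i, hi, j, hj, disjoint_left.2 fun v hv hv' => ?_⟩
  grind

/-- Cores of cross-intersecting families intersect: the two spread subfamilies still have members
that are disjoint outside the cores. -/
theorem not_disjoint_of_isCore [Finite V] (hAB : ∀ i ∈ A, ∀ j ∈ B, ¬ Disjoint (S i) (T j))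
    (hSk : ∀ i ∈ A, #(S i) ≤ k) (hTk : ∀ j ∈ B, #(T j) ≤ k) (hρ : 0 ≤ ρ)
    (h1 : 16 * (1 + 6 * ρ) ^ k ≤ 2 ^ m) (h2 : (1 + 128 * ρ) ^ m ≤ 2) (hX : IsCore A S ρ X)
    (hX' : IsCore B T ρ X') (hXρ : 2 * #X * ρ ≤ 1) (hXρ' : 2 * #X' * ρ ≤ 1) :
    ¬ Disjoint X X' := by
  intro hdisjoint
  obtain ⟨F, hFA, hFne, -, hF⟩ := hX
  obtain ⟨G, hGB, hGne, -, hG⟩ := hX'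
  have hcardF := card_le_two_mul_card_filter_disjoint hF hXρ'
  have hcardG := card_le_two_mul_card_filter_disjoint hG hXρ
  set F' := {i ∈ F | Disjoint X' (S i \ X)}
  set G' := {j ∈ G | Disjoint X (T j \ X')}
  have hF' : F'.Nonempty := by
    have hpos : (0 : ℝ) < #F := by exact_mod_cast hFne.card_pos
    exact card_pos.1 (by exact_mod_cast (by linarith : (0 : ℝ) < #F'))
  have hG' : G'.Nonempty := by
    have hpos : (0 : ℝ) < #G := by exact_mod_cast hGne.card_pos
    exact card_pos.1 (by exact_mod_cast (by linarith : (0 : ℝ) < #G'))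
  obtain ⟨i, hi, j, hj, hij⟩ := exists_disjoint_of_isSpread
    (hF.mono hρ (filter_subset _ _) hcardF fun _ _ => Subset.rfl) hF'
    (hG.mono hρ (filter_subset _ _) hcardG fun _ _ => Subset.rfl) hG' hρ
    (fun i hi => (card_le_card sdiff_subset).trans (hSk i (hFA (mem_filter.1 hi).1)))
    (fun j hj => (card_le_card sdiff_subset).trans (hTk j (hGB (mem_filter.1 hj).1))) h1 h2
  obtain ⟨hiF, hi⟩ := mem_filter.1 hi
  obtain ⟨hjG, hj⟩ := mem_filter.1 hj
  refine hAB i (hFA hiF) j (hGB hjG) (disjoint_left.2 fun v hv hv' => ?_)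
  have hvX' : v ∉ X' := fun h => disjoint_left.1 hi h
    (mem_sdiff.2 ⟨hv, disjoint_right.1 hdisjoint h⟩)
  have hvX : v ∉ X := fun h => disjoint_left.1 hj h (mem_sdiff.2 ⟨hv', hvX'⟩)
  exact disjoint_left.1 hij (mem_sdiff.2 ⟨hv, hvX⟩) (mem_sdiff.2 ⟨hv', hvX'⟩)

variable [Finite V]

theorem exists_isCore (S : ι → Finset V) (hR : R.Nonempty) (hρ : 0 < ρ) :
    ∃ X, IsCore R S ρ X ∧ #R * ρ ^ #X ≤ (#{i ∈ R | X ⊆ S i} : ℝ) := by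
  have := Fintype.ofFinite V
  obtain ⟨X, hX, hmax⟩ := exists_max_image
    {X : Finset V | #R * ρ ^ #X ≤ (#{i ∈ R | X ⊆ S i} : ℝ)} card ⟨∅, by simp⟩
  simp only [mem_filter, mem_univ, true_and] at hX hmax
  have : (0 : ℝ) < #R := by exact_mod_cast hR.card_pos
  have hne : {i ∈ R | X ⊆ S i}.Nonempty :=
    card_pos.1 (by exact_mod_cast (by positivity : 0 < #R * ρ ^ #X).trans_le hX)
  refine ⟨X, ⟨_, filter_subset _ _, hne, fun i hi => (mem_filter.1 hi).2, fun Y => ?_⟩, hX⟩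
  rcases Y.eq_empty_or_nonempty with rfl | hY
  · simp
  by_cases hXY : Disjoint X Y
  · have hY : #(X ∪ Y) = #X + #Y := card_union_of_disjoint hXY
    have hlt : (#{i ∈ R | X ∪ Y ⊆ S i} : ℝ) < #R * ρ ^ #(X ∪ Y) := by
      by_contra! hle
      have := hmax _ hle
      have := card_pos.2 ‹Y.Nonempty›
      omega
    calc (#{i ∈ {i ∈ R | X ⊆ S i} | Y ⊆ S i \ X} : ℝ) ≤ #{i ∈ R | X ∪ Y ⊆ S i} := by
          rw [filter_filter]
          gcongr with i
          exact fun h => union_subset h.1 (h.2.trans sdiff_subset)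
      _ ≤ #R * ρ ^ #X * ρ ^ #Y := by rw [mul_assoc, ← pow_add, ← hY]; exact hlt.le
      _ ≤ #{i ∈ R | X ⊆ S i} * ρ ^ #Y := by gcongr
  · rw [filter_false_of_mem fun i _ h => hXY (disjoint_of_subset_right h disjoint_sdiff)]
    simpa using by positivity

theorem card_le_of_forall_isCore_lt_card (hρ : 0 < ρ) (hE : 0 ≤ E)
    (hlarge : ∀ X : Finset V, q < #X → #{i ∈ A | X ⊆ S i} ≤ E * ρ ^ #X) (hRA : R ⊆ A)
    (hR : ∀ i ∈ R, ∀ X ⊆ S i, IsCore A S ρ X → q < #X) : #R ≤ E := by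
  rcases R.eq_empty_or_nonempty with rfl | hne
  · simpa using hE
  obtain ⟨X, hX, hcard⟩ := exists_isCore S hne hρ
  obtain ⟨i, hi, hXi⟩ : ∃ i ∈ R, X ⊆ S i := by
    obtain ⟨F, hFR, ⟨i, hi⟩, hFX, -⟩ := hX
    exact ⟨i, hFR hi, hFX i hi⟩
  refine le_of_mul_le_mul_right ?_ (pow_pos hρ #X)
  calc #R * ρ ^ #X ≤ #{i ∈ R | X ⊆ S i} := hcard
    _ ≤ #{i ∈ A | X ⊆ S i} := by gcongr
    _ ≤ E * ρ ^ #X := hlarge X (hR i hi X hXi (hX.mono hRA))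

theorem card_filter_forall_not_subset_le (hρ : 0 < ρ) (hE : 0 ≤ E)
    (hlarge : ∀ X : Finset V, q < #X → #{i ∈ A | X ⊆ S i} ≤ E * ρ ^ #X) {Q : Finset (Finset V)}
    (hQ : ∀ X, IsCore A S ρ X → #X ≤ q → ∃ P ∈ Q, P ⊆ X) :
    #{i ∈ A | ∀ P ∈ Q, ¬ P ⊆ S i} ≤ E := by
  refine card_le_of_forall_isCore_lt_card hρ hE hlarge (filter_subset _ _) fun i hi X hXi hX => ?_
  by_contra! hXq
  obtain ⟨P, hP, hPX⟩ := hQ X hX hXq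
  exact (mem_filter.1 hi).2 P hP (hPX.trans hXi)

theorem card_le_of_forall_isCore_exists_subset (hρ : 0 < ρ) (hE : 0 ≤ E)
    (hlarge : ∀ X : Finset V, q < #X → #{i ∈ A | X ⊆ S i} ≤ E * ρ ^ #X) {Q : Finset (Finset V)}
    (hD : ∀ P ∈ Q, #{i ∈ A | P ⊆ S i} ≤ D)
    (hQ : ∀ X, IsCore A S ρ X → #X ≤ q → ∃ P ∈ Q, P ⊆ X) : #A ≤ #Q * D + E := by
  classical
  have hcover : A ⊆ (Q.biUnion fun P => {i ∈ A | P ⊆ S i}) ∪ {i ∈ A | ∀ P ∈ Q, ¬ P ⊆ S i} := by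
    intro i hi
    simp only [mem_union, mem_biUnion, mem_filter]
    by_cases h : ∃ P ∈ Q, P ⊆ S i
    · exact .inl (h.imp fun P hP => ⟨hP.1, hi, hP.2⟩)
    · exact .inr ⟨hi, by simpa using h⟩
  calc (#A : ℝ) ≤ ∑ P ∈ Q, (#{i ∈ A | P ⊆ S i} : ℝ) + #{i ∈ A | ∀ P ∈ Q, ¬ P ⊆ S i} := by
        exact_mod_cast (card_le_card hcover).trans
          ((card_union_le _ _).trans (Nat.add_le_add_right card_biUnion_le _))
    _ ≤ #Q * D + E := by
        refine add_le_add ?_ (card_filter_forall_not_subset_le hρ hE hlarge hQ)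
        rw [← nsmul_eq_mul]
        exact sum_le_card_nsmul _ _ _ hD

end Core

section Stability

theorem exists_mem_of_forall_not_disjoint {V : Type*} {𝒞 𝒟 : Set (Finset V)} {q : ℕ}
    (h𝒞 : ∀ X ∈ 𝒞, #X ≤ q) (h𝒟 : ∀ Y ∈ 𝒟, #Y ≤ q) (hmeet : ∀ X ∈ 𝒞, ∀ Y ∈ 𝒟, ¬ Disjoint X Y)
    (hpair𝒞 : ∀ Q : Finset (Finset V), #Q ≤ q ^ 2 → (∀ P ∈ Q, #P = 2) →
      ∃ X ∈ 𝒞, ∀ P ∈ Q, ¬ P ⊆ X)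
    (hpair𝒟 : ∀ Q : Finset (Finset V), #Q ≤ q ^ 2 → (∀ P ∈ Q, #P = 2) →
      ∃ Y ∈ 𝒟, ∀ P ∈ Q, ¬ P ⊆ Y) :
    ∃ y, (∀ X ∈ 𝒞, y ∈ X) ∧ ∀ Y ∈ 𝒟, y ∈ Y := by
  classical
  by_cases hy : ∃ y, ∀ X ∈ 𝒞, y ∈ X
  · obtain ⟨y, hy⟩ := hy
    refine ⟨y, hy, fun Y hY => ?_⟩
    by_contra hyY
    obtain ⟨X, hX, hXQ⟩ := hpair𝒞 (Y.image fun x => {y, x})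
      (card_image_le.trans ((h𝒟 Y hY).trans (Nat.le_self_pow two_ne_zero q)))
      (forall_mem_image.2 fun x hx => card_pair fun h => hyY (h ▸ hx))
    obtain ⟨x, hxX, hxY⟩ := not_disjoint_iff.1 (hmeet X hX Y hY)
    exact hXQ _ (mem_image_of_mem _ hxY) (by simp [insert_subset_iff, hy X hX, hxX])
  · push Not at hy
    choose avoiding havoiding hnotMem using hy
    obtain ⟨X₀, hX₀, -⟩ := hpair𝒞 ∅ (by simp) (by simp)
    obtain ⟨Y, hY, hYQ⟩ := hpair𝒟 (X₀.biUnion fun y => (avoiding y).image fun x => {y, x})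
      (by
        rw [pow_two]
        exact (card_biUnion_le_card_mul _ _ q fun y _ =>
          card_image_le.trans (h𝒞 _ (havoiding y))).trans (Nat.mul_le_mul_right _ (h𝒞 _ hX₀)))
      (fun P hP => by
        obtain ⟨y, -, hP⟩ := mem_biUnion.1 hP
        obtain ⟨x, hx, rfl⟩ := mem_image.1 hP
        exact card_pair fun h => hnotMem y (h ▸ hx))
    obtain ⟨y, hyX, hyY⟩ := not_disjoint_iff.1 (hmeet X₀ hX₀ Y hY)
    obtain ⟨x, hxX, hxY⟩ := not_disjoint_iff.1 (hmeet _ (havoiding y) Y hY)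
    exact absurd (by simp [insert_subset_iff, hyY, hxY])
      (hYQ {y, x} (mem_biUnion.2 ⟨y, hyX, mem_image_of_mem _ hxX⟩))

variable {ι V : Type*} [DecidableEq V] [Finite V] {A B : Finset ι} {S : ι → Finset V} {k m q : ℕ}
  {ρ D E : ℝ}

theorem exists_isCore_forall_not_subset (hρ : 0 < ρ) (hD : 0 ≤ D) (hE : 0 ≤ E)
    (hpair : ∀ P : Finset V, #P = 2 → #{i ∈ A | P ⊆ S i} ≤ D)
    (hlarge : ∀ X : Finset V, q < #X → #{i ∈ A | X ⊆ S i} ≤ E * ρ ^ #X) (hA : q ^ 2 * D + E < #A)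
    {Q : Finset (Finset V)} (hQ : #Q ≤ q ^ 2) (hQ2 : ∀ P ∈ Q, #P = 2) :
    ∃ X, (IsCore A S ρ X ∧ #X ≤ q) ∧ ∀ P ∈ Q, ¬ P ⊆ X := by
  by_contra! hcover
  have hle := card_le_of_forall_isCore_exists_subset hρ hE hlarge (fun P hP => hpair P (hQ2 P hP))
    fun X hX hXq => hcover X ⟨hX, hXq⟩
  have hmul : #Q * D ≤ q ^ 2 * D := by
    gcongr
    exact_mod_cast hQ
  linarith

theorem card_filter_notMem_le_of_forall_isCore {y : V} (hρ : 0 < ρ) (hE : 0 ≤ E)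
    (hlarge : ∀ X : Finset V, q < #X → #{i ∈ A | X ⊆ S i} ≤ E * ρ ^ #X)
    (hy : ∀ X, IsCore A S ρ X → #X ≤ q → y ∈ X) : #{i ∈ A | y ∉ S i} ≤ E := by
  simpa using card_filter_forall_not_subset_le (Q := {{y}}) hρ hE hlarge
    fun X hX hXq => by simpa using hy X hX hXq

theorem exists_card_filter_notMem_le [Fintype ι] (hAB : ∀ i ∈ A, ∀ j ∈ B, ¬ Disjoint (S i) (S j))
    (hk : ∀ i, #(S i) ≤ k) (hρ : 0 < ρ) (hD : 0 ≤ D) (hE : 0 ≤ E) (hq : 2 * q * ρ ≤ 1)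
    (h1 : 16 * (1 + 6 * ρ) ^ k ≤ 2 ^ m) (h2 : (1 + 128 * ρ) ^ m ≤ 2)
    (hpair : ∀ P : Finset V, #P = 2 → #{i | P ⊆ S i} ≤ D)
    (hlarge : ∀ X : Finset V, q < #X → #{i | X ⊆ S i} ≤ E * ρ ^ #X)
    (hA : q ^ 2 * D + E < #A) (hB : q ^ 2 * D + E < #B) :
    ∃ y, #{i ∈ A | y ∉ S i} ≤ E ∧ #{i ∈ B | y ∉ S i} ≤ E := by
  have hsmall : ∀ X : Finset V, #X ≤ q → 2 * #X * ρ ≤ 1 := fun X hX => hq.trans' (by gcongr)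
  have hdegree : ∀ (F : Finset ι) (X : Finset V), (#{i ∈ F | X ⊆ S i} : ℝ) ≤ #{i | X ⊆ S i} :=
    fun F X => by
      gcongr
      exact subset_univ _
  have hpair : ∀ (F : Finset ι) (P : Finset V), #P = 2 → #{i ∈ F | P ⊆ S i} ≤ D :=
    fun F P hP => (hdegree F P).trans (hpair P hP)
  have hlarge : ∀ (F : Finset ι) (X : Finset V), q < #X → #{i ∈ F | X ⊆ S i} ≤ E * ρ ^ #X :=
    fun F X hX => (hdegree F X).trans (hlarge X hX)
  obtain ⟨y, hyA, hyB⟩ := exists_mem_of_forall_not_disjoint (q := q)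
    (𝒞 := {X | IsCore A S ρ X ∧ #X ≤ q}) (𝒟 := {X | IsCore B S ρ X ∧ #X ≤ q})
    (fun X hX => hX.2) (fun X hX => hX.2)
    (fun X hX Y hY => not_disjoint_of_isCore hAB (fun i _ => hk i) (fun i _ => hk i) hρ.le h1 h2
      hX.1 hY.1 (hsmall X hX.2) (hsmall Y hY.2))
    (fun Q => exists_isCore_forall_not_subset hρ hD hE (hpair A) (hlarge A) hA)
    (fun Q => exists_isCore_forall_not_subset hρ hD hE (hpair B) (hlarge B) hB)
  exact ⟨y, card_filter_notMem_le_of_forall_isCore hρ hE (hlarge A) fun X hX hXq => hyA X ⟨hX, hXq⟩,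
    card_filter_notMem_le_of_forall_isCore hρ hE (hlarge B) fun X hX hXq => hyB X ⟨hX, hXq⟩⟩

end Stability

section PermCounting

variable {α : Type*} [Fintype α] [DecidableEq α] {i x a b : α} {f g σ : Perm α}

/-- The graph of a permutation. Two permutations agree somewhere exactly when their graphs
meet, which turns families of permutations into set systems. -/
def graph (σ : Perm α) : Finset (α × α) := {p | σ p.1 = p.2}

theorem mem_graph {p : α × α} : p ∈ graph σ ↔ σ p.1 = p.2 := by simp [graph]

theorem card_graph (σ : Perm α) : #(graph σ) = Fintype.card α := by
  refine (card_nbij (i := Prod.fst) (t := univ) (by simp) ?_ fun x _ => ?_).trans card_univ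
  · rintro ⟨x, _⟩ hx ⟨y, _⟩ hy rfl
    simp_all [mem_graph]
  · exact ⟨(x, σ x), by simp [mem_graph]⟩

theorem card_filter_support_subset (P : Finset α) : #{σ : Perm α | σ.support ⊆ P} = (#P)! := by
  rw [← Fintype.card_coe P, ← Fintype.card_perm, ← Fintype.card_subtype]
  refine Fintype.card_congr ((subtypeEquivRight fun σ => ?_).trans
    (Perm.subtypeEquivSubtypePerm fun x => x ∈ P).symm)
  exact forall_congr' fun x => by rw [Perm.mem_support, not_imp_comm]

theorem card_filter_support_eq (P : Finset α) :
    #{σ : Perm α | σ.support = P} = numDerangements #P := by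
  rw [← Fintype.card_coe P, ← card_derangements_eq_numDerangements, ← Fintype.card_subtype]
  refine Fintype.card_congr ((subtypeEquivRight fun σ => ?_).trans
    (derangements.subtypeEquiv fun x => x ∈ P).symm)
  simp only [Finset.ext_iff, Perm.mem_support, Function.mem_fixedPoints, Function.IsFixedPt]
  exact forall_congr' fun x => by tauto

theorem card_filter_subset_graph_le (X : Finset (α × α)) :
    #{σ : Perm α | X ⊆ graph σ} ≤ (Fintype.card α - #X)! := by
  by_cases h : ∃ σ₀ : Perm α, X ⊆ graph σ₀
  · obtain ⟨σ₀, h₀⟩ := h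
    have hcard : #(X.image Prod.fst) = #X := by
      refine card_image_of_injOn ?_
      rintro ⟨x, _⟩ hx ⟨y, _⟩ hy rfl
      exact Prod.ext rfl ((mem_graph.1 (h₀ hx)).symm.trans (mem_graph.1 (h₀ hy)))
    rw [← hcard, ← card_compl, ← card_filter_support_subset]
    refine card_le_card_of_injOn (σ₀⁻¹ * ·) (fun σ hσ => ?_) (mul_right_injective _).injOn
    simp only [coe_filter, mem_univ, true_and, Set.mem_ofPred_eq] at hσ ⊢
    refine subset_compl_comm.1 fun x hx => ?_
    obtain ⟨p, hp, rfl⟩ := mem_image.1 hx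
    simp [mem_graph.1 (hσ hp), ← mem_graph.1 (h₀ hp)]
  · push Not at h
    simp [h]

theorem support_swap_mul_of_apply_eq (hix : i ≠ x) (hg : g i = i) :
    (swap i x * g).support = insert i (insert x g.support) := by
  ext u
  simp only [Perm.mem_support, Perm.mul_apply, mem_insert, ne_eq, swap_apply_eq_iff]
  rcases eq_or_ne u i with rfl | hui
  · simp [hg, hix]
  rcases eq_or_ne u x with rfl | hux
  · simpa [hui, hg] using fun h => hui (g.injective (h.trans hg.symm))
  · simp [swap_apply_of_ne_of_ne hui hux, hui, hux]

theorem support_eq_univ_and_apply_eq_iff (hix : i ≠ x) :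
    f.support = univ ∧ f i = x ↔
      (swap i x * f).support = {i}ᶜ ∨ (swap i x * f).support = {i, x}ᶜ := by
  obtain ⟨g, rfl⟩ : ∃ g, f = swap i x * g := ⟨swap i x * f, by simp⟩
  rw [swap_mul_self_mul, Perm.mul_apply, swap_apply_eq_iff, swap_apply_right]
  constructor
  · rintro ⟨hsupp, hg⟩
    rw [support_swap_mul_of_apply_eq hix hg] at hsupp
    have hgi : i ∉ g.support := by simpa using hg
    have hcover : ∀ u, u = i ∨ u = x ∨ u ∈ g.support := by
      simpa [Finset.ext_iff, -Perm.mem_support] using hsupp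
    by_cases hgx : x ∈ g.support
    · exact .inl (Finset.ext fun u => by grind [mem_compl])
    · exact .inr (Finset.ext fun u => by grind [mem_compl])
  · intro h
    have hg : g i = i := by
      rw [← Perm.notMem_support]
      rcases h with h | h <;> simp [h]
    refine ⟨?_, hg⟩
    rw [support_swap_mul_of_apply_eq hix hg]
    rcases h with h | h <;> ext u <;> simp [h] <;> tauto

theorem card_filter_support_eq_univ_apply_eq (hix : i ≠ x) :
    #{f : Perm α | f.support = univ ∧ f i = x} =
      numDerangements (Fintype.card α - 1) + numDerangements (Fintype.card α - 2) := by
  have hdisj : Disjoint (univ.filter fun g : Perm α => g.support = {i}ᶜ)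
      (univ.filter fun g : Perm α => g.support = {i, x}ᶜ) := by
    refine disjoint_filter.2 fun g _ h h' => ?_
    have hmem := h ▸ h'
    simpa [hix.symm] using Finset.ext_iff.1 hmem x
  rw [← card_singleton i, ← card_compl, ← card_pair hix, ← card_compl, ← card_filter_support_eq,
    ← card_filter_support_eq, ← card_union_of_disjoint hdisj, ← filter_or]
  exact card_equiv (Equiv.mulLeft (swap i x)) fun f => by
    simpa using support_eq_univ_and_apply_eq_iff hix

theorem exists_apply_eq_apply_eq_support_subset (hix : i ≠ x) (hab : a ≠ b) :
    ∃ θ : Perm α, θ i = a ∧ θ x = b ∧ θ.support ⊆ {i, x, a, b} := by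
  have ha : a ≠ swap i a x := fun h => hix ((swap i a).injective (by rwa [swap_apply_left]))
  refine ⟨swap b (swap i a x) * swap i a, ?_, ?_, fun u hu => ?_⟩
  · rw [Perm.mul_apply, swap_apply_left, swap_apply_of_ne_of_ne hab ha]
  · simp
  · by_contra hu'
    simp only [mem_insert, mem_singleton, not_or] at hu'
    obtain ⟨hui, hux, hua, hub⟩ := hu'
    have hfix : swap i a u = u := swap_apply_of_ne_of_ne hui hua
    refine Perm.mem_support.1 hu ?_
    rw [Perm.mul_apply, hfix, swap_apply_of_ne_of_ne hub]
    exact fun h => hux ((swap i a).injective (hfix.trans h))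

theorem numDerangements_le_card_filter_support_eq_univ (hix : i ≠ x) (hab : a ≠ b) (hia : i ≠ a)
    (hxb : x ≠ b) : numDerangements (Fintype.card α - 2) ≤
      #{f : Perm α | f.support = univ ∧ f i = a ∧ f x = b} := by
  obtain ⟨θ, hθi, hθx, hθ⟩ := exists_apply_eq_apply_eq_support_subset hix hab
  rw [← card_pair hix, ← card_compl, ← card_filter_support_eq]
  refine card_le_card_of_injOn (θ * ·) (fun g hg => ?_) (mul_right_injective _).injOn
  simp only [coe_filter, mem_univ, true_and, Set.mem_ofPred_eq, Perm.mul_apply] at hg ⊢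
  have hfix : ∀ u, g u = u ↔ u = i ∨ u = x := fun u => by
    rw [← Perm.notMem_support, hg, notMem_compl, mem_insert, mem_singleton]
  have hgi : g i = i := (hfix i).2 (.inl rfl)
  have hgx : g x = x := (hfix x).2 (.inr rfl)
  refine ⟨eq_univ_of_forall fun u => Perm.mem_support.2 fun hu => ?_, by rw [hgi, hθi],
    by rw [hgx, hθx]⟩
  rw [Perm.mul_apply] at hu
  have hne : ∀ v c, g v = v → θ v = c → v ≠ c → u ≠ v ∧ u ≠ c := by
    rintro v _ hgv rfl hv
    have huv : u ≠ v := by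
      rintro rfl
      exact hv (by rw [hgv] at hu; exact hu.symm)
    exact ⟨huv, fun h => huv (g.injective ((θ.injective (hu.trans h)).trans hgv.symm))⟩
  obtain ⟨hui, hua⟩ := hne i a hgi hθi hia
  obtain ⟨hux, hub⟩ := hne x b hgx hθx hxb
  have hθu : θ u = u := Perm.notMem_support.1 fun h => by simpa [hui, hux, hua, hub] using hθ h
  exact ((hfix u).1 (θ.injective (hu.trans hθu.symm))).elim hui hux

end PermCounting

section Coset

variable {n : ℕ} {i j x x' y y' : Fin n} {σ π τ : Perm (Fin n)}

theorem disjoint_graph_iff : Disjoint (graph σ) (graph τ) ↔ ¬ Intersects σ τ := by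
  simp only [disjoint_left, mem_graph, Prod.forall, Intersects, not_exists]
  exact ⟨fun h x hx => h x _ rfl hx.symm, fun h x y hσ hτ => h x (hσ.trans hτ.symm)⟩

theorem not_intersects_iff_support_eq_univ : ¬ Intersects σ τ ↔ (τ⁻¹ * σ).support = univ := by
  simp [Intersects, eq_univ_iff_forall, symm_apply_eq]

theorem mem_oneCoset : σ ∈ oneCoset i j ↔ σ i = j := by simp [oneCoset]

theorem card_oneCoset (i j : Fin n) : #(oneCoset i j) = (n - 1)! := by
  have hcard : #({i}ᶜ : Finset (Fin n)) = n - 1 := by simp [card_compl]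
  rw [← hcard, ← card_filter_support_subset]
  refine card_equiv (Equiv.mulLeft (swap i j)) fun σ => ?_
  rw [mem_oneCoset, mem_filter_univ, subset_compl_comm, singleton_subset_iff, mem_compl,
    Perm.notMem_support, Equiv.coe_mulLeft, Perm.mul_apply, swap_apply_eq_iff, swap_apply_left]

/-- The members of a 1-coset that do not intersect `τ`. -/
def cosetAvoiding (i j : Fin n) (τ : Perm (Fin n)) : Finset (Perm (Fin n)) :=
  {σ | σ i = j ∧ ¬ Intersects σ τ}

theorem card_cosetAvoiding (h : τ i ≠ j) :
    #(cosetAvoiding i j τ) = numDerangements (n - 1) + numDerangements (n - 2) := by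
  have hi : i ≠ τ⁻¹ j := by rwa [ne_eq, Perm.eq_inv_iff_eq]
  have hcount := card_filter_support_eq_univ_apply_eq hi
  rw [Fintype.card_fin] at hcount
  rw [← hcount]
  refine card_equiv (Equiv.mulLeft τ⁻¹) fun σ => ?_
  simp [cosetAvoiding, not_intersects_iff_support_eq_univ, and_comm]

theorem card_cosetMeeting_add (h : τ i ≠ j) :
    #(cosetMeeting i j τ) + (numDerangements (n - 1) + numDerangements (n - 2)) = (n - 1)! := by
  rw [← card_cosetAvoiding h, ← card_oneCoset i j, cosetMeeting, cosetAvoiding, oneCoset,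
    ← filter_filter, ← filter_filter, card_filter_add_card_filter_not]

theorem numDerangements_le_card_filter_cosetAvoiding (hix : i ≠ x) (hjy : j ≠ y) (hi : τ i ≠ j)
    (hx : τ x ≠ y) :
    numDerangements (n - 2) ≤ #{σ ∈ cosetAvoiding i j τ | σ x = y} := by
  have hi' : i ≠ τ⁻¹ j := by rwa [ne_eq, Perm.eq_inv_iff_eq]
  have hx' : x ≠ τ⁻¹ y := by rwa [ne_eq, Perm.eq_inv_iff_eq]
  have hcount := numDerangements_le_card_filter_support_eq_univ hix (τ⁻¹.injective.ne hjy) hi' hx'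
  rw [Fintype.card_fin] at hcount
  refine hcount.trans (card_equiv (Equiv.mulLeft τ⁻¹) fun σ => ?_).ge
  simp [cosetAvoiding, not_intersects_iff_support_eq_univ, and_comm, and_assoc]

/-- The members of a 1-coset that intersect `π` but not `τ`. -/
def cosetSeparating (i j : Fin n) (π τ : Perm (Fin n)) : Finset (Perm (Fin n)) :=
  {σ ∈ cosetAvoiding i j τ | Intersects σ π}

/-- The points where members of the 1-coset of `i ↦ j` are free to agree with `π` while avoiding
`τ`. -/
def freePoints (i j : Fin n) (π τ : Perm (Fin n)) : Finset (Fin n) :=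
  {x | x ≠ i ∧ π x ≠ j ∧ π x ≠ τ x}

/-- The points where two permutations agree. -/
def agreement (π τ : Perm (Fin n)) : Finset (Fin n) := {x | π x = τ x}

theorem le_card_freePoints_add (i j : Fin n) (π τ : Perm (Fin n)) :
    n ≤ #(freePoints i j π τ) + #(agreement π τ) + 2 := by
  have hcover : univ = freePoints i j π τ ∪ agreement π τ ∪ {i, π⁻¹ j} := by
    ext x
    simp only [freePoints, agreement, mem_union, mem_filter_univ, mem_insert, mem_singleton,
      Perm.eq_inv_iff_eq, mem_univ]
    tauto
  calc n = #(univ : Finset (Fin n)) := by simp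
    _ ≤ #(freePoints i j π τ ∪ agreement π τ) + #{i, π⁻¹ j} := hcover ▸ card_union_le _ _
    _ ≤ _ := add_le_add (card_union_le _ _) card_le_two

theorem freePoints_nonempty (hne : π ≠ τ) (hτ : τ i ≠ j) : (freePoints i j π τ).Nonempty := by
  obtain ⟨c, rfl⟩ := τ.surjective j
  by_cases hc : π c = τ c
  · have hcard : 1 < #(τ⁻¹ * π).support :=
      Perm.one_lt_card_support_of_ne_one fun h => hne (inv_mul_eq_one.1 h).symm
    obtain ⟨x, hx, hxi⟩ := exists_mem_ne hcard i
    have hxne : π x ≠ τ x := by simpa [symm_apply_eq] using hx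
    have hxc : x ≠ c := fun h => hxne (h ▸ hc)
    exact ⟨x, by simp [freePoints, hxi, hxne, ← hc, hxc]⟩
  · have hci : c ≠ i := fun h => hτ (h ▸ rfl)
    exact ⟨c, by simp [freePoints, hci, hc]⟩

theorem numDerangements_le_card_filter_cosetSeparating (hτ : τ i ≠ j)
    (hx : x ∈ freePoints i j π τ) :
    numDerangements (n - 2) ≤ #{σ ∈ cosetSeparating i j π τ | σ x = π x} := by
  simp only [freePoints, mem_filter_univ] at hx
  obtain ⟨hxi, hxj, hxτ⟩ := hx
  refine (numDerangements_le_card_filter_cosetAvoiding hxi.symm hxj.symm hτ hxτ.symm).trans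
    (card_le_card fun σ hσ => ?_)
  obtain ⟨hσ, hσx⟩ := mem_filter.1 hσ
  exact mem_filter.2 ⟨mem_filter.2 ⟨hσ, x, hσx⟩, hσx⟩

theorem numDerangements_le_card_cosetSeparating (hne : π ≠ τ) (hτ : τ i ≠ j) :
    numDerangements (n - 2) ≤ #(cosetSeparating i j π τ) := by
  obtain ⟨x, hx⟩ := freePoints_nonempty hne hτ
  exact (numDerangements_le_card_filter_cosetSeparating hτ hx).trans (card_filter_le _ _)

theorem card_filter_oneCoset_apply_eq_le (hxi : x ≠ i) :
    #{σ ∈ oneCoset i j | σ x = y} ≤ (n - 2)! := by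
  have h := card_filter_subset_graph_le {(i, j), (x, y)}
  rw [card_pair (by simp [hxi.symm]), Fintype.card_fin] at h
  refine h.trans' (card_le_card fun σ hσ => ?_)
  simpa [insert_subset_iff, mem_graph, oneCoset] using hσ

theorem card_filter_oneCoset_apply_eq_apply_eq_le (hxi : x ≠ i) (hxi' : x' ≠ i) (hxx' : x ≠ x') :
    #{σ ∈ oneCoset i j | σ x = y ∧ σ x' = y'} ≤ (n - 3)! := by
  have h := card_filter_subset_graph_le {(i, j), (x, y), (x', y')}
  rw [card_eq_three.2 ⟨_, _, _, by simp [hxi.symm], by simp [hxi'.symm], by simp [hxx'], rfl⟩,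
    Fintype.card_fin] at h
  refine h.trans' (card_le_card fun σ hσ => ?_)
  simpa [insert_subset_iff, mem_graph, oneCoset] using hσ

theorem sum_sq_card_filter_apply_eq_le (j : Fin n) (π : Perm (Fin n)) {T : Finset (Fin n)}
    (hT : i ∉ T) :
    ∑ σ ∈ oneCoset i j, #{x ∈ T | σ x = π x} ^ 2 ≤ #T * ((n - 2)! + #T * (n - 3)!) := by
  have hTi : ∀ x ∈ T, x ≠ i := fun x hx h => hT (h ▸ hx)
  have hsq : ∀ σ : Perm (Fin n), #{x ∈ T | σ x = π x} ^ 2 =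
      ∑ x ∈ T, ∑ x' ∈ T, if σ x = π x ∧ σ x' = π x' then 1 else 0 := fun σ => by
    rw [pow_two, ← card_product, ← filter_product, card_filter, sum_product]
  calc ∑ σ ∈ oneCoset i j, #{x ∈ T | σ x = π x} ^ 2
      = ∑ x ∈ T, ∑ x' ∈ T, #{σ ∈ oneCoset i j | σ x = π x ∧ σ x' = π x'} := by
        simp_rw [hsq, card_filter]
        rw [sum_comm]
        exact sum_congr rfl fun x _ => sum_comm
    _ ≤ ∑ _x ∈ T, ((n - 2)! + #T * (n - 3)!) := sum_le_sum fun x hx => ?_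
    _ = #T * ((n - 2)! + #T * (n - 3)!) := by simp
  rw [← add_sum_erase _ _ hx]
  refine add_le_add (by simpa using card_filter_oneCoset_apply_eq_le (hTi x hx)) ?_
  refine (sum_le_card_nsmul _ _ _ fun x' hx' => card_filter_oneCoset_apply_eq_apply_eq_le
    (hTi x hx) (hTi x' (mem_of_mem_erase hx')) (ne_of_mem_erase hx').symm).trans ?_
  exact Nat.mul_le_mul_right _ card_erase_le

theorem sq_card_freePoints_mul_numDerangements_le (hτ : τ i ≠ j) :
    (#(freePoints i j π τ) * numDerangements (n - 2)) ^ 2 ≤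
      #(cosetSeparating i j π τ) *
        (#(freePoints i j π τ) * ((n - 2)! + #(freePoints i j π τ) * (n - 3)!)) := by
  set T := freePoints i j π τ with hT
  have hfirst : #T * numDerangements (n - 2) ≤
      ∑ σ ∈ cosetSeparating i j π τ, #{x ∈ T | σ x = π x} := by
    refine le_trans ?_ (sum_card_bipartiteAbove_eq_sum_card_bipartiteBelow
      fun (σ : Perm (Fin n)) x => σ x = π x).ge
    exact card_nsmul_le_sum _ _ _ fun x hx => numDerangements_le_card_filter_cosetSeparating hτ hx
  calc (#T * numDerangements (n - 2)) ^ 2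
      ≤ (∑ σ ∈ cosetSeparating i j π τ, #{x ∈ T | σ x = π x}) ^ 2 := by gcongr
    _ ≤ #(cosetSeparating i j π τ) *
          ∑ σ ∈ cosetSeparating i j π τ, #{x ∈ T | σ x = π x} ^ 2 := sq_sum_le_card_mul_sum_sq
    _ ≤ #(cosetSeparating i j π τ) * ∑ σ ∈ oneCoset i j, #{x ∈ T | σ x = π x} ^ 2 := by
        gcongr
        simp +contextual [subset_iff, cosetSeparating, cosetAvoiding, oneCoset]
    _ ≤ _ := by
        gcongr
        exact sum_sq_card_filter_apply_eq_le j π (by simp [hT, freePoints])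

theorem card_filter_subset_agreement (π : Perm (Fin n)) (P : Finset (Fin n)) :
    #{τ | P ⊆ agreement π τ} = (n - #P)! := by
  have hcompl : #Pᶜ = n - #P := by rw [card_compl, Fintype.card_fin]
  rw [← hcompl, ← card_filter_support_subset]
  refine card_equiv (Equiv.mulLeft π⁻¹) fun τ => ?_
  rw [mem_filter_univ, mem_filter_univ, subset_compl_comm]
  simp [subset_iff, agreement, eq_symm_apply, eq_comm]

theorem card_filter_le_card_agreement_mul_factorial_le (π : Perm (Fin n)) {t : ℕ} (ht : t ≤ n) :
    #{τ | t ≤ #(agreement π τ)} * t ! ≤ n ! := by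
  have hcover : univ.filter (fun τ => t ≤ #(agreement π τ)) ⊆
      (powersetCard t univ).biUnion fun P => {τ | P ⊆ agreement π τ} := fun τ hτ => by
    obtain ⟨P, hP, hPt⟩ := exists_subset_card_eq ((mem_filter_univ τ).1 hτ)
    exact mem_biUnion.2 ⟨P, mem_powersetCard.2 ⟨subset_univ _, hPt⟩, (mem_filter_univ _).2 hP⟩
  have hcard : ∀ P ∈ powersetCard t (univ : Finset (Fin n)),
      #{τ | P ⊆ agreement π τ} ≤ (n - t)! := fun P hP => by
    rw [card_filter_subset_agreement, (mem_powersetCard.1 hP).2]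
  calc #{τ | t ≤ #(agreement π τ)} * t !
      ≤ #(powersetCard t (univ : Finset (Fin n))) * (n - t)! * t ! := by
        gcongr
        exact (card_le_card hcover).trans (card_biUnion_le_card_mul _ _ _ hcard)
    _ = n.choose t * t ! * (n - t)! := by
        rw [card_powersetCard, card_univ, Fintype.card_fin, mul_right_comm]
    _ = n ! := Nat.choose_mul_factorial_mul_factorial ht

end Coset

section Extremal

variable {n : ℕ} {A B : Finset (Perm (Fin n))} {i j : Fin n} {σ π τ ρ : Perm (Fin n)}

/-- `#A ≥ (n - 1)! - d_{n-1} - d_{n-2} + 1`, the threshold of the theorem, arranged so as to avoid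
truncated subtraction. -/
def IsLarge (A : Finset (Perm (Fin n))) : Prop :=
  (n - 1)! + 1 ≤ #A + (numDerangements (n - 1) + numDerangements (n - 2))

/-- The pairs of families for which equality holds in the theorem. -/
def IsExtremalPair (A B : Finset (Perm (Fin n))) : Prop :=
  ∃ (i j : Fin n) (τ ρ : Perm (Fin n)), Intersects τ ρ ∧ τ i ≠ j ∧ ρ i ≠ j ∧
    A = cosetMeeting i j τ ∪ {ρ} ∧ B = cosetMeeting i j ρ ∪ {τ}

theorem CrossIntersecting.symm (hAB : CrossIntersecting A B) : CrossIntersecting B A :=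
  fun τ hτ σ hσ => (hAB σ hσ τ hτ).imp fun _ => Eq.symm

theorem CrossIntersecting.inter_oneCoset_subset_cosetMeeting (hAB : CrossIntersecting A B)
    (hτ : τ ∈ B) : A ∩ oneCoset i j ⊆ cosetMeeting i j τ := fun σ hσ => by
  obtain ⟨hσA, hσ⟩ := mem_inter.1 hσ
  exact (mem_filter_univ σ).2 ⟨mem_oneCoset.1 hσ, hAB σ hσA τ hτ⟩

theorem CrossIntersecting.card_inter_oneCoset_add_le (hAB : CrossIntersecting A B) (hπ : π ∈ B)
    (hτ : τ ∈ B) :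
    #(A ∩ oneCoset i j) + #(cosetSeparating i j π τ) ≤ #(cosetMeeting i j π) := by
  have hdisj : Disjoint (A ∩ oneCoset i j) (cosetSeparating i j π τ) :=
    disjoint_left.2 fun σ hσ hsep => by
      simp only [cosetSeparating, cosetAvoiding, mem_filter, mem_univ, true_and] at hsep
      exact hsep.1.2 (hAB σ (mem_inter.1 hσ).1 τ hτ)
  rw [← card_union_of_disjoint hdisj]
  refine card_le_card (union_subset (hAB.inter_oneCoset_subset_cosetMeeting hπ) ?_)
  simp +contextual [subset_iff, cosetSeparating, cosetAvoiding, cosetMeeting]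

/-- In the coset, the members of `A` meet `π` and miss `cosetSeparating i j π τ`; a large `A` has to
make up for that loss outside the coset. -/
theorem card_cosetSeparating_lt_of_mem_sdiff (hAB : CrossIntersecting A B) (hA : IsLarge A)
    (hπ : π ∈ B \ oneCoset i j) (hτ : τ ∈ B) :
    #(cosetSeparating i j π τ) < #(A \ oneCoset i j) := by
  rw [mem_sdiff, mem_oneCoset] at hπ
  have hsep := hAB.card_inter_oneCoset_add_le (i := i) (j := j) hπ.1 hτ
  have hmeet := card_cosetMeeting_add hπ.2
  have hsplit := card_inter_add_card_sdiff A (oneCoset i j)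
  unfold IsLarge at hA
  omega

theorem card_sdiff_oneCoset_le_numDerangements {E t : ℕ} (hAB : CrossIntersecting A B)
    (hA : IsLarge A) (hAE : #(A \ oneCoset i j) ≤ E)
    (hsep : ∀ π τ, τ i ≠ j → #(agreement π τ) < t → E ≤ #(cosetSeparating i j π τ))
    (hagree : ∀ π : Perm (Fin n), #{τ | t ≤ #(agreement π τ)} ≤ numDerangements (n - 2)) :
    #(B \ oneCoset i j) ≤ numDerangements (n - 2) := by
  rcases (B \ oneCoset i j).eq_empty_or_nonempty with hempty | ⟨π, hπ⟩
  · simp [hempty]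
  refine (card_le_card fun τ hτ => (mem_filter_univ τ).2 ?_).trans (hagree π)
  by_contra! hlt
  rw [mem_sdiff, mem_oneCoset] at hτ
  exact (hAE.trans (hsep π τ hτ.2 hlt)).not_gt
    (card_cosetSeparating_lt_of_mem_sdiff hAB hA hπ hτ.1)

theorem eq_of_mem_sdiff_oneCoset (hAB : CrossIntersecting A B) (hA : IsLarge A)
    (hA' : #(A \ oneCoset i j) ≤ numDerangements (n - 2)) (hπ : π ∈ B \ oneCoset i j)
    (hτ : τ ∈ B \ oneCoset i j) : π = τ := by
  by_contra hne
  have hlt := card_cosetSeparating_lt_of_mem_sdiff hAB hA hπ (mem_sdiff.1 hτ).1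
  rw [mem_sdiff, mem_oneCoset] at hτ
  exact hlt.not_ge (hA'.trans (numDerangements_le_card_cosetSeparating hne hτ.2))

theorem sdiff_oneCoset_nonempty (hAB : CrossIntersecting A B) (hA : IsLarge A)
    (hnot : ¬ (A ⊆ oneCoset i j ∧ B ⊆ oneCoset i j)) : (A \ oneCoset i j).Nonempty := by
  rw [sdiff_nonempty]
  intro hsub
  obtain ⟨τ, hτ⟩ := sdiff_nonempty.2 fun h => hnot ⟨hsub, h⟩
  have hlt := card_cosetSeparating_lt_of_mem_sdiff hAB hA hτ (mem_sdiff.1 hτ).1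
  rw [sdiff_eq_empty_iff_subset.2 hsub] at hlt
  exact Nat.not_lt_zero _ hlt

theorem eq_cosetMeeting_union_singleton (hAB : CrossIntersecting A B) (hA : IsLarge A)
    (hρ : A \ oneCoset i j = {ρ}) (hτ : τ ∈ B) (hτij : τ i ≠ j) :
    A = cosetMeeting i j τ ∪ {ρ} := by
  have hsplit := card_inter_add_card_sdiff A (oneCoset i j)
  rw [hρ, card_singleton] at hsplit
  have hmeet := card_cosetMeeting_add hτij
  unfold IsLarge at hA
  have hinter : A ∩ oneCoset i j = cosetMeeting i j τ :=
    eq_of_subset_of_card_le (hAB.inter_oneCoset_subset_cosetMeeting hτ) (by omega)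
  rw [← hinter, ← hρ, union_comm, sdiff_union_inter]

theorem isExtremalPair_of_card_sdiff_oneCoset_le {E t : ℕ} (hAB : CrossIntersecting A B)
    (hA : IsLarge A) (hB : IsLarge B) (hnot : ¬ (A ⊆ oneCoset i j ∧ B ⊆ oneCoset i j))
    (hAE : #(A \ oneCoset i j) ≤ E) (hBE : #(B \ oneCoset i j) ≤ E)
    (hsep : ∀ π τ, τ i ≠ j → #(agreement π τ) < t → E ≤ #(cosetSeparating i j π τ))
    (hagree : ∀ π : Perm (Fin n), #{τ | t ≤ #(agreement π τ)} ≤ numDerangements (n - 2)) :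
    IsExtremalPair A B := by
  have hBA := hAB.symm
  have hA' := card_sdiff_oneCoset_le_numDerangements hBA hB hBE hsep hagree
  have hB' := card_sdiff_oneCoset_le_numDerangements hAB hA hAE hsep hagree
  obtain ⟨ρ, hρ⟩ := sdiff_oneCoset_nonempty hAB hA hnot
  obtain ⟨τ, hτ⟩ := sdiff_oneCoset_nonempty hBA hB fun h => hnot h.symm
  have hAρ : A \ oneCoset i j = {ρ} :=
    eq_singleton_iff_unique_mem.2 ⟨hρ, fun σ hσ => eq_of_mem_sdiff_oneCoset hBA hB hB' hσ hρ⟩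
  have hBτ : B \ oneCoset i j = {τ} :=
    eq_singleton_iff_unique_mem.2 ⟨hτ, fun σ hσ => eq_of_mem_sdiff_oneCoset hAB hA hA' hσ hτ⟩
  rw [mem_sdiff, mem_oneCoset] at hρ hτ
  exact ⟨i, j, τ, ρ, hBA τ hτ.1 ρ hρ.1, hτ.2, hρ.2,
    eq_cosetMeeting_union_singleton hAB hA hAρ hτ.1 hτ.2,
    eq_cosetMeeting_union_singleton hBA hB hBτ hρ.1 hρ.2⟩

theorem card_cosetMeeting_union_singleton_add (hτ : τ i ≠ j) (hρ : ρ i ≠ j) :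
    #(cosetMeeting i j τ ∪ {ρ}) + (numDerangements (n - 1) + numDerangements (n - 2)) =
      (n - 1)! + 1 := by
  have hdisj : Disjoint (cosetMeeting i j τ) {ρ} := by simp [cosetMeeting, hρ]
  have := card_cosetMeeting_add hτ
  rw [card_union_of_disjoint hdisj, card_singleton]
  omega

theorem card_familyC_add (hn : 2 ≤ n) :
    #(familyC n hn) + (numDerangements (n - 1) + numDerangements (n - 2)) = (n - 1)! + 1 :=
  card_cosetMeeting_union_singleton_add (by simp) (by simp)

theorem isLarge_iff_card_familyC_le (hn : 2 ≤ n) : IsLarge A ↔ #(familyC n hn) ≤ #A := by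
  rw [IsLarge, ← card_familyC_add hn, add_le_add_iff_right]

theorem IsExtremalPair.min_card_eq (hAB : IsExtremalPair A B) (hn : 2 ≤ n) :
    min #A #B = #(familyC n hn) := by
  obtain ⟨i, j, τ, ρ, -, hτ, hρ, rfl, rfl⟩ := hAB
  have hA := card_cosetMeeting_union_singleton_add hτ hρ
  have hB := card_cosetMeeting_union_singleton_add hρ hτ
  have hC := card_familyC_add hn
  omega

end Extremal

section Estimates

open Filter

theorem eventually_factorial_le_three_mul_numDerangements :
    ∀ᶠ m in atTop, m ! ≤ 3 * numDerangements m := by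
  have hexp : 1 / 3 < Real.exp (-1) := by
    rw [Real.exp_neg, one_div]
    exact inv_strictAnti₀ (Real.exp_pos 1) Real.exp_one_lt_three
  filter_upwards [numDerangements_tendsto_inv_e.eventually_const_lt hexp] with m hm
  rw [div_lt_div_iff₀ (by norm_num) (by positivity), one_mul, mul_comm] at hm
  exact_mod_cast hm.le

theorem eventually_five_mul_numDerangements_le :
    ∀ᶠ m in atTop, 5 * numDerangements m ≤ 2 * m ! := by
  have hexp : Real.exp (-1) < 2 / 5 := by
    rw [Real.exp_neg, inv_lt_comm₀ (Real.exp_pos 1) (by norm_num)]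
    exact Real.exp_one_gt_d9.trans' (by norm_num)
  filter_upwards [numDerangements_tendsto_inv_e.eventually_lt_const hexp] with m hm
  rw [div_lt_div_iff₀ (by positivity) (by norm_num), mul_comm] at hm
  exact_mod_cast hm.le

theorem eventually_exists_core_size :
    ∀ᶠ n in atTop, ∃ q, 100 * n ≤ 2 ^ q ∧ 10 * q ^ 2 + 1 ≤ n := by
  have hpow : ∀ q, 20 ≤ q → 1000 * (q + 1) ^ 2 ≤ 2 ^ q := fun q hq => by
    induction q, hq using Nat.le_induction with
    | base => norm_num
    | succ q hq ih =>
      rw [pow_succ 2]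
      nlinarith
  filter_upwards [eventually_ge_atTop 4001] with n hn
  have hlower := Nat.sqrt_le' ((n - 1) / 10)
  have hupper : (n - 1) / 10 < (Nat.sqrt ((n - 1) / 10) + 1) ^ 2 := Nat.lt_succ_sqrt' _
  have hq := hpow (Nat.sqrt ((n - 1) / 10)) (Nat.le_sqrt'.2 (by omega))
  exact ⟨Nat.sqrt ((n - 1) / 10), by omega, by omega⟩

theorem succ_pow_le_three_mul_pow {k m : ℕ} (hk : k ≤ m) : (m + 1) ^ k ≤ 3 * m ^ k := by
  rcases m.eq_zero_or_pos with rfl | hm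
  · simp [Nat.le_zero.1 hk]
  have hinv : (1 : ℝ) ≤ 1 + (m : ℝ)⁻¹ := le_add_of_nonneg_right (by positivity)
  suffices ((m : ℝ) + 1) ^ k ≤ 3 * (m : ℝ) ^ k by exact_mod_cast this
  calc ((m : ℝ) + 1) ^ k = (1 + (m : ℝ)⁻¹) ^ k * (m : ℝ) ^ k := by
        rw [← mul_pow, add_mul, inv_mul_cancel₀ (by positivity), one_mul]
    _ ≤ (1 + (m : ℝ)⁻¹) ^ m * (m : ℝ) ^ k := by gcongr
    _ ≤ 3 * (m : ℝ) ^ k := by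
        gcongr
        exact Real.one_add_inv_pow_le_exp.trans Real.exp_one_lt_three.le

theorem add_pow_mul_factorial_le (k d : ℕ) : (k + d) ^ k * d ! ≤ 3 ^ k * (k + d)! := by
  induction k with
  | zero => simp
  | succ k ih =>
    calc (k + 1 + d) ^ (k + 1) * d ! = (k + d + 1) * ((k + d + 1) ^ k * d !) := by ring
      _ ≤ (k + d + 1) * (3 * (k + d) ^ k * d !) := by
          gcongr
          exact succ_pow_le_three_mul_pow (Nat.le_add_right k d)
      _ = 3 * (k + d + 1) * ((k + d) ^ k * d !) := by ring
      _ ≤ 3 * (k + d + 1) * (3 ^ k * (k + d)!) := by gcongr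
      _ = 3 ^ (k + 1) * (k + 1 + d)! := by
          rw [add_right_comm k 1 d, Nat.factorial_succ]
          ring

theorem card_filter_subset_graph_le_of_lt_card {n q : ℕ} (hn : 0 < n) (hq : 100 * n ≤ 2 ^ q)
    {X : Finset (Fin n × Fin n)} (hX : q < #X) :
    (#{σ : Perm (Fin n) | X ⊆ graph σ} : ℝ) ≤ (n - 1)! / 100 * (6 / n) ^ #X := by
  rcases lt_or_ge n #X with hXn | hXn
  · have hempty : (univ.filter fun σ : Perm (Fin n) => X ⊆ graph σ) = ∅ :=
      filter_eq_empty_iff.2 fun σ _ hσ =>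
        hXn.not_ge ((card_le_card hσ).trans_eq (by rw [card_graph, Fintype.card_fin]))
    rw [hempty, card_empty, Nat.cast_zero]
    positivity
  have hcard := card_filter_subset_graph_le X
  rw [Fintype.card_fin] at hcard
  have hfac := add_pow_mul_factorial_le #X (n - #X)
  rw [Nat.add_sub_cancel' hXn, ← Nat.mul_factorial_pred hn.ne'] at hfac
  have hscaled : 100 * n ^ #X * (n - #X)! ≤ (n - 1)! * 6 ^ #X :=
    calc 100 * n ^ #X * (n - #X)! = 100 * (n ^ #X * (n - #X)!) := mul_assoc ..
      _ ≤ 100 * (3 ^ #X * (n * (n - 1)!)) := by gcongr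
      _ = (n - 1)! * (100 * n * 3 ^ #X) := by ring
      _ ≤ (n - 1)! * (2 ^ #X * 3 ^ #X) := by
          gcongr
          exact hq.trans (Nat.pow_le_pow_right two_pos hX.le)
      _ = (n - 1)! * 6 ^ #X := by rw [← mul_pow]; rfl
  rw [div_pow, div_mul_div_comm, le_div_iff₀ (by positivity), mul_comm]
  exact_mod_cast (Nat.mul_le_mul_left _ hcard).trans hscaled

theorem card_freePoints_mul_factorial_le {n : ℕ} (hn : 4 ≤ n)
    (hd : (n - 2)! ≤ 3 * numDerangements (n - 2)) {i j : Fin n} {π τ : Perm (Fin n)}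
    (hτ : τ i ≠ j) : #(freePoints i j π τ) * (n - 2)! ≤ 27 * #(cosetSeparating i j π τ) := by
  rcases (#(freePoints i j π τ)).eq_zero_or_pos with hT | hT
  · simp [hT]
  have hTn : #(freePoints i j π τ) ≤ 2 * (n - 2) := by
    have := card_finset_fin_le (freePoints i j π τ)
    omega
  have hfac : #(freePoints i j π τ) * (n - 3)! ≤ 2 * (n - 2)! := by
    rw [← Nat.mul_factorial_pred (n := n - 2) (by omega), ← mul_assoc, Nat.sub_sub]
    gcongr
  have hmoment := sq_card_freePoints_mul_numDerangements_le (π := π) hτ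
  refine Nat.le_of_mul_le_mul_left ?_ (Nat.mul_pos hT (n - 2).factorial_pos)
  calc #(freePoints i j π τ) * (n - 2)! * (#(freePoints i j π τ) * (n - 2)!)
      = (#(freePoints i j π τ) * (n - 2)!) ^ 2 := (sq _).symm
    _ ≤ (#(freePoints i j π τ) * (3 * numDerangements (n - 2))) ^ 2 := by gcongr
    _ = 9 * (#(freePoints i j π τ) * numDerangements (n - 2)) ^ 2 := by ring
    _ ≤ 9 * (#(cosetSeparating i j π τ) *
          (#(freePoints i j π τ) * ((n - 2)! + 2 * (n - 2)!))) := by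
        gcongr
        exact hmoment.trans (by gcongr)
    _ = #(freePoints i j π τ) * (n - 2)! * (27 * #(cosetSeparating i j π τ)) := by ring

theorem eventually_factorial_le_card_cosetSeparating :
    ∀ᶠ n in atTop, ∀ (i j : Fin n) (π τ : Perm (Fin n)), τ i ≠ j → #(agreement π τ) < n / 4 →
      (n - 1)! ≤ 100 * #(cosetSeparating i j π τ) := by
  filter_upwards [eventually_ge_atTop 8,
    (tendsto_sub_atTop_nat 2).eventually eventually_factorial_le_three_mul_numDerangements]
    with n hn hd i j π τ hτ hagree
  have hfree := le_card_freePoints_add i j π τ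
  have hsep := card_freePoints_mul_factorial_le (by omega) hd hτ (π := π)
  have hmul : (n - 1) * (n - 2)! ≤ 3 * #(freePoints i j π τ) * (n - 2)! := by
    gcongr
    omega
  rw [← Nat.mul_factorial_pred (n := n - 1) (by omega), Nat.sub_sub]
  linarith

theorem eventually_card_filter_le_card_agreement_le :
    ∀ᶠ n in atTop, ∀ π : Perm (Fin n),
      #{τ | n / 4 ≤ #(agreement π τ)} ≤ numDerangements (n - 2) := by
  have hfac : ∀ t, 7 ≤ t → 48 * (t + 1) ^ 2 ≤ t ! := fun t ht => by
    induction t, ht using Nat.le_induction with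
    | base => decide
    | succ t ht ih =>
      rw [Nat.factorial_succ]
      nlinarith
  filter_upwards [eventually_ge_atTop 28,
    (tendsto_sub_atTop_nat 2).eventually eventually_factorial_le_three_mul_numDerangements]
    with n hn hd π
  have hn2 : n ! ≤ n ^ 2 * (n - 2)! := by
    rw [← Nat.mul_factorial_pred (n := n) (by omega),
      ← Nat.mul_factorial_pred (n := n - 1) (by omega), Nat.sub_sub, ← mul_assoc, sq]
    gcongr
    omega
  have hquarter : 3 * n ^ 2 ≤ (n / 4)! :=
    calc 3 * n ^ 2 ≤ 3 * (4 * (n / 4 + 1)) ^ 2 := by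
          gcongr
          omega
      _ = 48 * (n / 4 + 1) ^ 2 := by ring
      _ ≤ (n / 4)! := hfac _ (by omega)
  refine Nat.le_of_mul_le_mul_right ?_ (n / 4).factorial_pos
  calc #{τ | n / 4 ≤ #(agreement π τ)} * (n / 4)! ≤ n ! :=
        card_filter_le_card_agreement_mul_factorial_le π (Nat.div_le_self n 4)
    _ ≤ n ^ 2 * (3 * numDerangements (n - 2)) := hn2.trans (by gcongr)
    _ = numDerangements (n - 2) * (3 * n ^ 2) := by ring
    _ ≤ numDerangements (n - 2) * (n / 4)! := by gcongr

theorem eventually_factorial_lt_two_mul_card_of_isLarge :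
    ∀ᶠ n in atTop, ∀ A : Finset (Perm (Fin n)), IsLarge A → (n - 1)! < 2 * #A := by
  filter_upwards [eventually_ge_atTop 5,
    (tendsto_sub_atTop_nat 1).eventually eventually_five_mul_numDerangements_le,
    (tendsto_sub_atTop_nat 2).eventually eventually_five_mul_numDerangements_le]
    with n hn hd₁ hd₂ A hA
  have hfac : 4 * (n - 2)! ≤ (n - 1)! := by
    rw [← Nat.mul_factorial_pred (n := n - 1) (by omega), Nat.sub_sub]
    gcongr
    omega
  unfold IsLarge at hA
  omega

theorem eventually_sixteen_mul_one_add_div_pow_le :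
    ∀ᶠ n : ℕ in atTop, 16 * (1 + 6 * (6 / (n : ℝ))) ^ n ≤ 2 ^ 64 := by
  have hexp : Real.exp 36 < 2 ^ 60 :=
    calc Real.exp 36 = Real.exp 1 ^ 36 := by rw [← Real.exp_nat_mul]; norm_num
      _ < 3 ^ 36 := by
          gcongr
          exact Real.exp_one_lt_three
      _ < 2 ^ 60 := by norm_num
  filter_upwards [(Real.tendsto_one_add_div_pow_exp 36).eventually_lt_const hexp] with n hn
  rw [← mul_div_assoc]
  linarith

theorem eventually_one_add_div_pow_le_two :
    ∀ᶠ n : ℕ in atTop, (1 + 128 * (6 / (n : ℝ))) ^ 64 ≤ 2 := by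
  have hlim : Tendsto (fun n : ℕ => (1 + 128 * (6 / (n : ℝ))) ^ 64) atTop (nhds 1) := by
    simpa using (((tendsto_const_div_atTop_nhds_zero_nat (6 : ℝ)).const_mul 128).const_add 1).pow 64
  exact hlim.eventually_le_const one_lt_two

/-- Stability, from the spread approximation applied to graphs of permutations. A set of more than
`q` points lies in so few of the graphs that `E = (n - 1)! / 100` and `ρ = 6 / n` are admissible. -/
theorem eventually_exists_card_sdiff_oneCoset_le :
    ∀ᶠ n in atTop, ∀ A B : Finset (Perm (Fin n)), CrossIntersecting A B → IsLarge A → IsLarge B →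
      ∃ i j, 100 * #(A \ oneCoset i j) ≤ (n - 1)! ∧ 100 * #(B \ oneCoset i j) ≤ (n - 1)! := by
  filter_upwards [eventually_ge_atTop 14, eventually_exists_core_size,
    eventually_sixteen_mul_one_add_div_pow_le, eventually_one_add_div_pow_le_two,
    eventually_factorial_lt_two_mul_card_of_isLarge]
    with n hn ⟨q, hq, hqn⟩ h1 h2 hhalf A B hAB hA hB
  have hpos : (0 : ℝ) < n := by positivity
  have hcores : q ^ 2 * (n - 2)! * 10 ≤ (n - 1)! := by
    rw [← Nat.mul_factorial_pred (n := n - 1) (by omega), Nat.sub_sub, mul_right_comm]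
    gcongr
    omega
  have hcoresR : (q : ℝ) ^ 2 * (n - 2)! * 10 ≤ (n - 1)! := by exact_mod_cast hcores
  have hlt : ∀ F : Finset (Perm (Fin n)), IsLarge F →
      (q : ℝ) ^ 2 * (n - 2)! + (n - 1)! / 100 < #F := fun F hF => by
    have hF : ((n - 1)! : ℝ) < 2 * #F := by exact_mod_cast hhalf F hF
    linarith
  have hqρ : 2 * q * (6 / (n : ℝ)) ≤ 1 := by
    rw [mul_div_assoc', div_le_one hpos]
    have hqnR : 10 * (q : ℝ) ^ 2 + 1 ≤ n := by exact_mod_cast hqn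
    have hnR : (14 : ℝ) ≤ n := by exact_mod_cast hn
    nlinarith [sq_nonneg ((q : ℝ) - 1)]
  have hpair : ∀ P : Finset (Fin n × Fin n), #P = 2 →
      (#{σ : Perm (Fin n) | P ⊆ graph σ} : ℝ) ≤ (n - 2)! := fun P hP => by
    have h := card_filter_subset_graph_le P
    rw [hP, Fintype.card_fin] at h
    exact_mod_cast h
  obtain ⟨⟨i, j⟩, hAE, hBE⟩ := exists_card_filter_notMem_le (S := graph) (m := 64)
    (fun σ hσ τ hτ => disjoint_graph_iff.not_left.2 (hAB σ hσ τ hτ))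
    (fun σ => (card_graph σ).trans_le (Fintype.card_fin n).le) (by positivity) (by positivity)
    (by positivity) hqρ h1 h2 hpair
    (fun X hX => card_filter_subset_graph_le_of_lt_card (by omega) hq hX) (hlt A hA) (hlt B hB)
  have hsdiff : ∀ F : Finset (Perm (Fin n)), {σ ∈ F | (i, j) ∉ graph σ} = F \ oneCoset i j :=
    fun F => by ext σ; simp [mem_graph, mem_oneCoset]
  rw [hsdiff, le_div_iff₀' (by norm_num)] at hAE hBE
  exact ⟨i, j, by exact_mod_cast hAE, by exact_mod_cast hBE⟩

theorem eventually_isExtremalPair :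
    ∀ᶠ n in atTop, ∀ A B : Finset (Perm (Fin n)), CrossIntersecting A B →
      (¬ ∃ i j, A ⊆ oneCoset i j ∧ B ⊆ oneCoset i j) → IsLarge A → IsLarge B →
      IsExtremalPair A B := by
  filter_upwards [eventually_exists_card_sdiff_oneCoset_le,
    eventually_factorial_le_card_cosetSeparating, eventually_card_filter_le_card_agreement_le]
    with n hstable hsep hagree A B hAB hnot hA hB
  obtain ⟨i, j, hAE, hBE⟩ := hstable A B hAB hA hB
  exact isExtremalPair_of_card_sdiff_oneCoset_le (E := (n - 1)! / 100) hAB hA hB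
    (fun h => hnot ⟨i, j, h⟩) (by omega) (by omega)
    (fun π τ hτ hlt => Nat.div_le_of_le_mul (hsep i j π τ hτ hlt)) hagree

end Estimates

end CrossInt

theorem mainTheorem7 :
    ∃ N : ℕ, ∀ (n : ℕ) (h2 : 2 ≤ n), N ≤ n →
      ((CrossInt.familyC n h2).card : ℤ) =
        (Nat.factorial (n - 1) : ℤ) - (numDerangements (n - 1) : ℤ)
          - (numDerangements (n - 2) : ℤ) + 1 ∧
      ∀ A B : Finset (Equiv.Perm (Fin n)),
        CrossInt.CrossIntersecting A B →
        (¬ ∃ i j : Fin n, A ⊆ CrossInt.oneCoset i j ∧ B ⊆ CrossInt.oneCoset i j) →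
        min A.card B.card ≤ (CrossInt.familyC n h2).card ∧
        (min A.card B.card = (CrossInt.familyC n h2).card ↔
          ∃ (i j : Fin n) (τ ρ : Equiv.Perm (Fin n)),
            CrossInt.Intersects τ ρ ∧ τ i ≠ j ∧ ρ i ≠ j ∧
            A = CrossInt.cosetMeeting i j τ ∪ {ρ} ∧
            B = CrossInt.cosetMeeting i j ρ ∪ {τ}) := by
  obtain ⟨N, hN⟩ := Filter.eventually_atTop.1 CrossInt.eventually_isExtremalPair
  refine ⟨N, fun n h2 hn => ⟨?_, fun A B hAB hnot => ?_⟩⟩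
  · have hcard := CrossInt.card_familyC_add h2
    omega
  have hextremal : (CrossInt.familyC n h2).card ≤ min A.card B.card →
      CrossInt.IsExtremalPair A B := fun hle =>
    hN n hn A B hAB hnot ((CrossInt.isLarge_iff_card_familyC_le h2).2 (hle.trans (min_le_left _ _)))
      ((CrossInt.isLarge_iff_card_familyC_le h2).2 (hle.trans (min_le_right _ _)))
  refine ⟨?_, fun heq => hextremal heq.ge, fun h => CrossInt.IsExtremalPair.min_card_eq h h2⟩
  by_contra! hlt
  exact hlt.ne' ((hextremal hlt.le).min_card_eq h2)
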